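/- **Conventions.** A Courant algebroid (CA) is a smooth vector bundle $E\to M$ with a non-degenerate symmetric pairing $\langle\,,\rangle$ on the fibres, an anchor $\rho:E\to TM$ and an $\mathbb R$-bilinear bracket $[\,,]$ on $\Gamma(E)$ such that, with $u\cdot f:=\rho(u)f$ and $\langle u,d_Ef\rangle=u\cdot f$, $[u,[v,w]]=[[u,v],w]+[v,[u,w]]$, $[u,fv]=f[u,v]+(u\cdot f)v$, $u\cdot\langle v,w\rangle=\langle[u,v],w\rangle+\langle v,[u,w]\rangle$ and $[u,v]+[v,u]=d_E\langle u,v\rangle$. A divergence is an $\mathbb R$-linear map $\operatorname{div}:\Gamma(E)\to C^\infty(M)$ with $\operatorname{div}(fa)=f\operatorname{div}a+a\cdot f$. A generalized pseudometric is a subbundle $V_+\subset E$ on which $\langle\,,\rangle$ is non-degenerate; $V_-:=V_+^\perp$, and subscripts $\pm$ denote the orthogonal projections. For $a_+\in\Gamma(V_+)$, $b_-\in\Gamma(V_-)$ put $$\mathrm{GRic}^E_{V_+,\operatorname{div}}(a_+,b_-):=\operatorname{div}[b_-,a_+]_+-b_-\cdot\operatorname{div}a_+-\operatorname{Tr}_{V_+}[[\,\cdot\,,b_-]_-,a_+]_+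 .$$ Let $\mathsf S$ be a connected Lie group with Lie algebra $\mathfrak s$. A CA $E\to M$ is $\mathsf S$-equivariant (for the zero pairing on $\mathfrak s$) if it is given a linear map $\chi:\mathfrak s\to\Gamma(E)$, injective at every point of $M$, with $[\chi(s),\chi(t)]=\chi([s,t])$ and $\langle\chi(s),\chi(t)\rangle=0$, and smooth actions of $\mathsf S$ on $M$ and on $E$ (by vector bundle automorphisms over the action on $M$) which integrate the infinitesimal actions $\rho(\chi(s))$ and $[\chi(s),\cdot\,]$. Let $\mathfrak s_E\subset E$ be the subbundle with fibres $\chi_x(\mathfrak s)$; a superscript $\mathfrak s$ denotes invariant sections, i.e. those $a$ with $[\chi(s),a]=0$ for all $s\in\mathfrak s$. A divergence is equivariant if $\chi(s)\cdot\operatorname{div}x=\operatorname{div}[\chi(s),x]$ and $\operatorname{div}\chi(s)=-\operatorname{Tr}_{\mathfrak s}\mathrm{ad}_s$ for all $s\in\mathfrak s$, $x\in\Gamma(E)$. A generalized pseudometric $V_+$ is admissible if it is $\mathfrak s$-invariant ($[\chi(s),\Gamma(V_+)]\subset\Gamma(V_+)$) and $V_+\subset\mathfrak s_E^\perp$. If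 $\mathsf S$ acts freely and properly on $M$, let $\pi:M\to M/\mathsf S$ be the quotient manifold (with $\pi$ a submersion) and let $E_{/\mathsf S}\to M/\mathsf S$ be the quotient of the bundle $\mathfrak s_E^\perp/\mathfrak s_E\to M$ by $\mathsf S$. Every $a\in\Gamma(\mathfrak s_E^\perp)^{\mathfrak s}$ induces a section $\tilde a$ of $E_{/\mathsf S}$, which identifies $\Gamma(E_{/\mathsf S})\cong\Gamma(\mathfrak s_E^\perp)^{\mathfrak s}/\Gamma(\mathfrak s_E)^{\mathfrak s}$. The reduced CA structure on $E_{/\mathsf S}$ is the one induced by $E$: $\langle\tilde a,\tilde b\rangle\circ\pi=\langle a,b\rangle$, $\tilde\rho(\tilde a)\circ\pi=d\pi(\rho(a))$, $[\tilde a,\tilde b]=\widetilde{[a,b]}$. An equivariant divergence induces $\widetilde{\operatorname{div}}$ on $E_{/\mathsf S}$ by $\widetilde{\operatorname{div}}(\tilde a)\circ\pi=\operatorname{div}a$, and an admissible $V_+$ induces a generalized pseudometric $\tilde V_+\subset E_{/\mathsf S}$, its fibrewise image. **Theorem.** Let $E\to M$ be an $\mathsf S$-equivariant CA such that the action of $\mathsf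 S$ on $M$ is free and proper, let $V_+\subset E$ be an admissible generalized pseudometric and $\operatorname{div}$ an equivariant divergence on $E$. If $a_+\in\Gamma(V_+)^{\mathfrak s}$ and $b_-\in\Gamma(V_-\cap\mathfrak s_E^\perp)^{\mathfrak s}$, and if $\tilde a_+$, $\tilde b_-$ are the corresponding sections of $\tilde V_+$ and $\tilde V_-$, then $$\mathrm{GRic}^E_{V_+,\operatorname{div}}(a_+,b_-)=\pi^*\,\mathrm{GRic}^{E_{/\mathsf S}}_{\tilde V_+,\widetilde{\operatorname{div}}}(\tilde a_+,\tilde b_-).$$ -/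

import Mathlib

open Bundle
open scoped Manifold ContDiff Topology

noncomputable section CourantAlgebroids

section Basic

variable {EM : Type*} [NormedAddCommGroup EM] [NormedSpace ℝ EM]
  {HM : Type*} [TopologicalSpace HM] (I : ModelWithCorners ℝ EM HM)
  {M : Type*} [TopologicalSpace M] [ChartedSpace HM M]
  (FE : Type*) [NormedAddCommGroup FE] [NormedSpace ℝ FE]
  (E : M → Type*) [TopologicalSpace (TotalSpace FE E)] [∀ x, TopologicalSpace (E x)]
  [∀ x, AddCommGroup (E x)] [∀ x, Module ℝ (E x)] [FiberBundle FE E] [VectorBundle ℝ FE E]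

/-- The structure maps of a Courant algebroid on a smooth vector bundle `E → M` (without any
axioms): a bilinear form on the fibres, an anchor `E → TM`, and a bracket on smooth sections. -/
structure CourantData where
  pairing : ∀ x, LinearMap.BilinForm ℝ (E x)
  anchor : ∀ x, E x →ₗ[ℝ] TangentSpace I x
  bracket : Cₛ^∞⟮I; FE, E⟯ → Cₛ^∞⟮I; FE, E⟯ → Cₛ^∞⟮I; FE, E⟯

variable {I FE E}

/-- The product `f a` of a smooth function and a smooth section. -/
def funSmul (f : C^∞⟮I, M; ℝ⟯) (a : Cₛ^∞⟮I; FE, E⟯) : Cₛ^∞⟮I; FE, E⟯ :=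
  ⟨fun x => f x • a x, f.contMDiff.smul_section a.contMDiff⟩

/-- `u · f = ρ(u) f`, the derivative of the function `f` along the anchor of `u`. -/
def CourantData.act (C : CourantData I FE E) (u : Cₛ^∞⟮I; FE, E⟯) (f : M → ℝ) (x : M) : ℝ :=
  mfderiv I 𝓘(ℝ, ℝ) f x (C.anchor x (u x))

/-- The function `⟨u, v⟩` on `M`. -/
def CourantData.pair (C : CourantData I FE E) (u v : Cₛ^∞⟮I; FE, E⟯) (x : M) : ℝ :=
  C.pairing x (u x) (v x)

variable (I FE E) in
/-- A Courant algebroid structure on the smooth vector bundle `E → M`. -/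
structure CourantAlgebroid [IsManifold I ∞ M] extends CourantData I FE E where
  pairing_symm : ∀ x (u v : E x), pairing x u v = pairing x v u
  pairing_nondegenerate : ∀ x (u : E x), (∀ v, pairing x u v = 0) → u = 0
  pairing_smooth : ∀ u v : Cₛ^∞⟮I; FE, E⟯,
    ContMDiff I 𝓘(ℝ, ℝ) ∞ (toCourantData.pair u v)
  anchor_smooth : ∀ u : Cₛ^∞⟮I; FE, E⟯,
    ContMDiff I I.tangent ∞ (fun x => (⟨x, anchor x (u x)⟩ : TangentBundle I M))
  bracket_add_left : ∀ u v w, bracket (u + v) w = bracket u w + bracket v w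
  bracket_add_right : ∀ u v w, bracket u (v + w) = bracket u v + bracket u w
  bracket_smul_left : ∀ (c : ℝ) u v, bracket (c • u) v = c • bracket u v
  bracket_smul_right : ∀ (c : ℝ) u v, bracket u (c • v) = c • bracket u v
  jacobi : ∀ u v w, bracket u (bracket v w) = bracket (bracket u v) w + bracket v (bracket u w)
  leibniz : ∀ u (f : C^∞⟮I, M; ℝ⟯) v x,
    bracket u (funSmul f v) x = f x • bracket u v x + toCourantData.act u f x • v x
  pairing_invariant : ∀ u v w x,
    toCourantData.act u (toCourantData.pair v w) x
      = pairing x (bracket u v x) (w x) + pairing x (v x) (bracket u w x)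
  /-- `[u, v] + [v, u] = d_E ⟨u, v⟩`, where `⟨w, d_E f⟩ = w · f` for all `w`. -/
  bracket_add_swap : ∀ u v w x,
    pairing x (w x) ((bracket u v + bracket v u) x)
      = toCourantData.act w (toCourantData.pair u v) x

/-- A divergence on a Courant algebroid. -/
structure Divergence [IsManifold I ∞ M] (C : CourantAlgebroid I FE E) where
  toLin : Cₛ^∞⟮I; FE, E⟯ →ₗ[ℝ] C^∞⟮I, M; ℝ⟯
  leibniz : ∀ (f : C^∞⟮I, M; ℝ⟯) (a : Cₛ^∞⟮I; FE, E⟯) (x : M),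
    toLin (funSmul f a) x = f x * toLin a x + C.act a f x

/-- A family of subspaces of the fibres is a smooth subbundle: near every point it is spanned by
pointwise linearly independent smooth sections. -/
def IsSmoothSubbundle (I : ModelWithCorners ℝ EM HM) (FE : Type*) [NormedAddCommGroup FE]
    [NormedSpace ℝ FE] {E : M → Type*} [TopologicalSpace (TotalSpace FE E)]
    [∀ x, TopologicalSpace (E x)] [∀ x, AddCommGroup (E x)] [∀ x, Module ℝ (E x)]
    [FiberBundle FE E] [VectorBundle ℝ FE E] (V : ∀ x, Submodule ℝ (E x)) : Prop :=
  ∀ x₀ : M, ∃ (r : ℕ) (s : Fin r → Cₛ^∞⟮I; FE, E⟯), ∀ᶠ x in 𝓝 x₀,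
    LinearIndependent ℝ (fun i => s i x) ∧ Submodule.span ℝ (Set.range fun i => s i x) = V x

/-- A generalized pseudometric: a subbundle `V₊ ⊆ E` on which the pairing is nondegenerate. -/
structure IsGeneralizedPseudometric [IsManifold I ∞ M] (C : CourantAlgebroid I FE E)
    (V : ∀ x, Submodule ℝ (E x)) : Prop where
  subbundle : IsSmoothSubbundle I FE V
  nondegenerate : ∀ x, ∀ u ∈ V x, (∀ v ∈ V x, C.pairing x u v = 0) → u = 0

namespace CourantData

variable (C : CourantData I FE E) (V : ∀ x, Submodule ℝ (E x))

/-- `V₋ = V₊^⊥`. -/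
def minus (x : M) : Submodule ℝ (E x) := (C.pairing x).orthogonal (V x)

/-- `a ↦ a₊`: the smooth section of `V₊` that differs from `a` by a section of `V₋` (it exists and
is unique if `V₊` is a generalized pseudometric). -/
def plusPart (a : Cₛ^∞⟮I; FE, E⟯) : Cₛ^∞⟮I; FE, E⟯ :=
  Classical.epsilon fun s => ∀ x, s x ∈ V x ∧ a x - s x ∈ C.minus V x

/-- `a ↦ a₋ = a - a₊`. -/
def minusPart (a : Cₛ^∞⟮I; FE, E⟯) : Cₛ^∞⟮I; FE, E⟯ := a - C.plusPart V a

/-- The endomorphism of the fibre of `V₊` at `x` induced by the function-linear map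
`v ↦ [[v, b]₋, a]₊` on sections of `V₊`. -/
def ricciEnd (a b : Cₛ^∞⟮I; FE, E⟯) (x : M) : Module.End ℝ (V x) :=
  Classical.epsilon fun T => ∀ (v : Cₛ^∞⟮I; FE, E⟯) (hv : ∀ y, v y ∈ V y),
    (T ⟨v x, hv x⟩ : E x)
      = C.plusPart V (C.bracket (C.minusPart V (C.bracket v b)) a) x

/-- The generalized Ricci tensor
`GRic(a, b) = div [b, a]₊ - b · div a - Tr_{V₊} [[·, b]₋, a]₊`
of `(V₊, div)`, evaluated on a section `a` of `V₊` and a section `b` of `V₋`. -/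
def GRic (div : Cₛ^∞⟮I; FE, E⟯ → C^∞⟮I, M; ℝ⟯) (a b : Cₛ^∞⟮I; FE, E⟯) (x : M) : ℝ :=
  div (C.plusPart V (C.bracket b a)) x - C.act b (div a) x
    - LinearMap.trace ℝ (V x) (C.ricciEnd V a b x)

end CourantData

end Basic

/-- A smooth Lie group is a `C^3` Lie group, which is what the Lie algebra structure on
`GroupLieAlgebra` needs. -/
instance lieGroup_minSmoothness_three {ES : Type*} [NormedAddCommGroup ES] [NormedSpace ℝ ES]
    {HS : Type*} [TopologicalSpace HS] (IS : ModelWithCorners ℝ ES HS) (S : Type*)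
    [TopologicalSpace S] [ChartedSpace HS S] [Group S] [LieGroup IS ∞ S] :
    LieGroup IS (minSmoothness ℝ 3) S := by
  rw [minSmoothness_of_isRCLikeNormedField]
  infer_instance

section Equivariant

variable {EM : Type*} [NormedAddCommGroup EM] [NormedSpace ℝ EM]
  {HM : Type*} [TopologicalSpace HM] {I : ModelWithCorners ℝ EM HM}
  {M : Type*} [TopologicalSpace M] [ChartedSpace HM M] [IsManifold I ∞ M]
  {FE : Type*} [NormedAddCommGroup FE] [NormedSpace ℝ FE]
  {E : M → Type*} [TopologicalSpace (TotalSpace FE E)] [∀ x, TopologicalSpace (E x)]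
  [∀ x, AddCommGroup (E x)] [∀ x, Module ℝ (E x)] [FiberBundle FE E] [VectorBundle ℝ FE E]
  {ES : Type*} [NormedAddCommGroup ES] [NormedSpace ℝ ES]
  {HS : Type*} [TopologicalSpace HS] (IS : ModelWithCorners ℝ ES HS)
  (S : Type*) [TopologicalSpace S] [ChartedSpace HS S] [Group S] [MulAction S M]

/-- An `S`-equivariant structure (for the zero pairing on the Lie algebra `𝔰` of `S`) on a Courant
algebroid `E → M` whose base carries an action of `S`: a pointwise injective, isotropic,
bracket-preserving linear map `χ : 𝔰 → Γ(E)`, and a smooth action of `S` on `E` by vector bundle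
automorphisms over the action on `M`, which integrate the infinitesimal actions `ρ(χ(s))` on `M`
and `[χ(s), ·]` on `E`.

`pull g x : E (g • x) → E x` is the action of `g⁻¹` on the fibre over `g • x`, so that
`(g⁻¹ · a) x = pull g x (a (g • x))` for a section `a`. The Lie algebra of `S` is that of
left-invariant vector fields; for a left action, `u ↦ - d/dt (exp (t u) • x)` at `t = 0` is the
Lie algebra morphism into the vector fields on `M`, whence the signs. -/
structure EquivariantStructure (C : CourantAlgebroid I FE E) where
  χ : GroupLieAlgebra IS S →ₗ[ℝ] Cₛ^∞⟮I; FE, E⟯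
  χ_bracket : ∀ s t, C.bracket (χ s) (χ t) = χ ⁅s, t⁆
  χ_isotropic : ∀ s t x, C.pairing x (χ s x) (χ t x) = 0
  χ_injective : ∀ x, Function.Injective fun s => χ s x
  pull : ∀ (g : S) (x : M), E (g • x) →ₗ[ℝ] E x
  pull_one : ∀ (a : ∀ x, E x) (x : M), pull 1 x (a ((1 : S) • x)) = a x
  pull_mul : ∀ (g h : S) (a : ∀ x, E x) (x : M),
    pull (g * h) x (a ((g * h) • x)) = pull h x (pull g (h • x) (a (g • h • x)))
  pull_smooth : ∀ a : Cₛ^∞⟮I; FE, E⟯,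
    ContMDiff (IS.prod I) (I.prod 𝓘(ℝ, FE)) ∞
      (fun p : S × M => (⟨p.2, pull p.1 p.2 (a (p.1 • p.2))⟩ : TotalSpace FE E))
  integrates_base : ∀ (s : GroupLieAlgebra IS S) (f : C^∞⟮I, M; ℝ⟯) (x : M),
    mfderiv IS 𝓘(ℝ, ℝ) (fun g : S => f (g • x)) 1 s = - C.act (χ s) f x
  integrates : ∀ (s : GroupLieAlgebra IS S) (a : Cₛ^∞⟮I; FE, E⟯) (x : M) (φ : E x →ₗ[ℝ] ℝ),
    mfderiv IS 𝓘(ℝ, ℝ) (fun g : S => φ (pull g x (a (g • x)))) 1 s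
      = - φ (C.bracket (χ s) a x)

namespace EquivariantStructure

variable {IS S} {C : CourantAlgebroid I FE E} (K : EquivariantStructure IS S C)

/-- The fibre of `𝔰_E ⊆ E`, the image of `χ`. -/
def sE (x : M) : Submodule ℝ (E x) where
  carrier := {u | ∃ s, K.χ s x = u}
  add_mem' := by
    rintro _ _ ⟨s, rfl⟩ ⟨t, rfl⟩
    exact ⟨s + t, by simp⟩
  zero_mem' := ⟨0, by simp⟩
  smul_mem' := by
    rintro c _ ⟨s, rfl⟩
    exact ⟨c • s, by simp⟩

/-- The fibre of `𝔰_E^⊥ ⊆ E`. -/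
def sPerp (x : M) : Submodule ℝ (E x) := (C.pairing x).orthogonal (K.sE x)

/-- `𝔰`-invariant sections. -/
def IsInvariant (a : Cₛ^∞⟮I; FE, E⟯) : Prop := ∀ s, C.bracket (K.χ s) a = 0

/-- A generalized pseudometric is admissible if it is `𝔰`-invariant and contained in `𝔰_E^⊥`. -/
structure IsAdmissible (V : ∀ x, Submodule ℝ (E x)) : Prop where
  pseudometric : IsGeneralizedPseudometric C V
  invariant : ∀ (s : GroupLieAlgebra IS S) (a : Cₛ^∞⟮I; FE, E⟯), (∀ x, a x ∈ V x) →
    ∀ x, C.bracket (K.χ s) a x ∈ V x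
  le_sPerp : ∀ x, V x ≤ K.sPerp x

/-- Equivariant divergences. -/
structure IsEquivariantDiv [CompleteSpace ES] [LieGroup IS ∞ S]
    (div : Divergence C) : Prop where
  equivariant : ∀ (s : GroupLieAlgebra IS S) (a : Cₛ^∞⟮I; FE, E⟯) (x : M),
    C.act (K.χ s) (div.toLin a) x = div.toLin (C.bracket (K.χ s) a) x
  unimodular : ∀ (s : GroupLieAlgebra IS S) (x : M),
    div.toLin (K.χ s) x
      = - LinearMap.trace ℝ (GroupLieAlgebra IS S) (LieAlgebra.ad ℝ (GroupLieAlgebra IS S) s)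

variable {EN : Type*} [NormedAddCommGroup EN] [NormedSpace ℝ EN]
  {HN : Type*} [TopologicalSpace HN] (IN : ModelWithCorners ℝ EN HN)
  {N : Type*} [TopologicalSpace N] [ChartedSpace HN N] (pr : M → N)
  (FF : Type*) [NormedAddCommGroup FF] [NormedSpace ℝ FF]
  (F : N → Type*) [TopologicalSpace (TotalSpace FF F)] [∀ y, TopologicalSpace (F y)]
  [∀ y, AddCommGroup (F y)] [∀ y, Module ℝ (F y)] [FiberBundle FF F] [VectorBundle ℝ FF F]

/-- For the projection `pr : M → N = M/S`: a smooth `S`-invariant bundle map `q : 𝔰_E^⊥ → F` over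
`pr` that is onto on every fibre, with kernel `𝔰_E`. It presents the vector bundle `F → N` as the
quotient of `𝔰_E^⊥ / 𝔰_E → M` by `S`, and determines `F` up to a unique isomorphism. -/
structure QuotientBundleMap where
  q : ∀ x, K.sPerp x →ₗ[ℝ] F (pr x)
  surjective : ∀ x, Function.Surjective (q x)
  eq_zero_iff : ∀ x (u : K.sPerp x), q x u = 0 ↔ (u : E x) ∈ K.sE x
  smooth : ∀ (a : Cₛ^∞⟮I; FE, E⟯) (ha : ∀ x, a x ∈ K.sPerp x),
    ContMDiff I (IN.prod 𝓘(ℝ, FF)) ∞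
      (fun x => (⟨pr x, q x ⟨a x, ha x⟩⟩ : TotalSpace FF F))
  invariant : ∀ (g : S) (x : M) (u : K.sPerp (g • x)) (v : K.sPerp x),
    (v : E x) = K.pull g x u →
      (⟨pr x, q x v⟩ : TotalSpace FF F) = ⟨pr (g • x), q (g • x) u⟩

namespace QuotientBundleMap

variable {K IN pr FF F} (Q : K.QuotientBundleMap IN pr FF F)

/-- `a` is an `𝔰`-invariant section of `𝔰_E^⊥` and `σ` is the section of the quotient bundle
that it induces. -/
def Descends (a : Cₛ^∞⟮I; FE, E⟯) (σ : Cₛ^∞⟮IN; FF, F⟯) : Prop :=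
  K.IsInvariant a ∧ ∀ x, ∃ h : a x ∈ K.sPerp x, Q.q x ⟨a x, h⟩ = σ (pr x)

/-- The section of the quotient bundle induced by an invariant section `a` of `𝔰_E^⊥`. -/
def descend (a : Cₛ^∞⟮I; FE, E⟯) : Cₛ^∞⟮IN; FF, F⟯ :=
  Classical.epsilon fun σ => Q.Descends a σ

/-- The reduced Courant algebroid `E_{/S} → M/S`: the structure maps on the quotient bundle
`F` induced by those of `E`, via `Γ(F) = Γ(𝔰_E^⊥)^𝔰 / Γ(𝔰_E)^𝔰`. -/
def reduced : CourantData IN FF F where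
  pairing := Classical.epsilon fun B : ∀ y, LinearMap.BilinForm ℝ (F y) =>
    ∀ x (u v : K.sPerp x), B (pr x) (Q.q x u) (Q.q x v) = C.pairing x u v
  anchor := Classical.epsilon fun r : ∀ y, F y →ₗ[ℝ] TangentSpace IN y =>
    ∀ x (u : K.sPerp x), r (pr x) (Q.q x u) = mfderiv I IN pr x (C.anchor x u)
  bracket σ τ := Classical.epsilon fun υ : Cₛ^∞⟮IN; FF, F⟯ =>
    ∀ a b, Q.Descends a σ → Q.Descends b τ → Q.Descends (C.bracket a b) υ

/-- The reduction of a subbundle `V ⊆ 𝔰_E^⊥`: its image in the quotient bundle. -/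
def reducedSubbundle (V : ∀ x, Submodule ℝ (E x)) (y : N) : Submodule ℝ (F y) :=
  Submodule.span ℝ {w | ∃ (x : M) (u : K.sPerp x), (u : E x) ∈ V x ∧
    (⟨pr x, Q.q x u⟩ : TotalSpace FF F) = ⟨y, w⟩}

/-- The divergence on the reduced Courant algebroid induced by a divergence on `E`. -/
def reducedDiv (div : Divergence C) (σ : Cₛ^∞⟮IN; FF, F⟯) : C^∞⟮IN, N; ℝ⟯ :=
  Classical.epsilon fun f : C^∞⟮IN, N; ℝ⟯ =>
    ∀ a, Q.Descends a σ → ∀ x, f (pr x) = div.toLin a x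

end QuotientBundleMap

end EquivariantStructure

end Equivariant

end CourantAlgebroids

/-! Reduction passes from invariant sections of `𝔰_E^⊥` to their classes modulo `𝔰_E`, and every
ingredient of the generalized Ricci tensor commutes with it. Brackets: an invariant section of
`𝔰_E^⊥` commutes with all `χ(s)`, so bracketing with it preserves `𝔰_E^⊥` and `𝔰_E`. Divergences: on
an invariant section `∑ fᵢ χ(sᵢ)` the terms `χ(sᵢ) · fᵢ` cancel the traces of `ad` prescribed by
equivariance (`IsEquivariantDiv.eq_zero_of_mem_sE`). Projections: `V₊` is nondegenerate and
orthogonal to `𝔰_E`, so it meets `𝔰_E` only in zero, and the quotient map is a fibrewise isometry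
from `V₊` onto the reduced subbundle.

The trace runs over a whole fibre of `V₊`, while reduction sees only invariant sections. But `v ↦
[[v, b]₋, a]₊` is linear over functions (`ricciEnd_spec`), so it can be tested on invariant
sections, and every section of the reduced subbundle lifts to one (`exists_descends_of_mem`). The
two endomorphisms are therefore conjugate (`trace_ricciEnd`).

The reduced structure maps are chosen by their defining properties, so the existence of such maps
has to be proved. This needs invariance under the group, whereas most hypotheses are infinitesimal.
The passage from `𝔰` to `S` is a uniqueness argument: in a local frame, the failure of invariance
solves a linear first-order system along right translations and vanishes at `1`, hence near `1`
(`eventually_eq_zero_of_mfderiv_mul_le`); connectedness does the rest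
(`mem_of_eventually_mul_mem_iff`). Smoothness on the quotient is checked along local sections of the
submersion. -/

set_option linter.unusedSectionVars false

/-! ### Smooth coefficients and cutoff functions -/

section Frames

variable {EM : Type*} [NormedAddCommGroup EM] [NormedSpace ℝ EM]
  {HM : Type*} [TopologicalSpace HM] {I : ModelWithCorners ℝ EM HM}
  {M : Type*} [TopologicalSpace M] [ChartedSpace HM M]

/-- Coefficients of a smooth vector-valued function with respect to smooth, pointwise linearly
independent functions are smooth. -/
theorem contMDiffAt_coeff {ι : Type*} [Fintype ι] {G : Type*} [NormedAddCommGroup G]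
    [NormedSpace ℝ G] [FiniteDimensional ℝ G] {w : ι → M → G} {t : M → G} {c : ι → M → ℝ} {x₀ : M}
    (hw : ∀ i, ContMDiffAt I 𝓘(ℝ, G) ∞ (w i) x₀) (ht : ContMDiffAt I 𝓘(ℝ, G) ∞ t x₀)
    (hli : LinearIndependent ℝ fun i => w i x₀) (h : ∀ᶠ x in 𝓝 x₀, t x = ∑ i, c i x • w i x)
    (i : ι) : ContMDiffAt I 𝓘(ℝ, ℝ) ∞ (c i) x₀ := by
  classical
  let e : ι → (ι → ℝ) →L[ℝ] ℝ := fun i => ContinuousLinearMap.proj i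
  let A : M → ((ι → ℝ) →L[ℝ] G) := fun x => ∑ i, (e i).smulRight (w i x)
  have hAapp : ∀ x v, A x v = ∑ i, v i • w i x := fun x v => by
    simp [A, e]
  have hA : ContMDiffAt I 𝓘(ℝ, (ι → ℝ) →L[ℝ] G) ∞ A x₀ := by
    apply contMDiffAt_finsetSum
    intro i _
    exact ((ContinuousLinearMap.smulRightL ℝ (ι → ℝ) G (e i)).contMDiff.contMDiffAt).comp x₀ (hw i)
  have hinj : LinearMap.ker (A x₀ : (ι → ℝ) →ₗ[ℝ] G) = ⊥ := by
    rw [LinearMap.ker_eq_bot']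
    intro v hv
    funext i
    exact Fintype.linearIndependent_iff.1 hli v ((hAapp x₀ v).symm.trans hv) i
  -- Composing with a fixed left inverse `L` of `A x₀` gives a square matrix `B x = L (A x)` with `B
  -- x₀ = 1`. It is invertible near `x₀`, so the coefficients are `B⁻¹ L t`, and inversion is
  -- smooth.
  obtain ⟨L, hL⟩ := LinearMap.exists_leftInverse_of_injective _ hinj
  let L' : G →L[ℝ] (ι → ℝ) := L.toContinuousLinearMap
  let B : M → ((ι → ℝ) →L[ℝ] (ι → ℝ)) := fun x => L'.comp (A x)
  have hB : ContMDiffAt I 𝓘(ℝ, (ι → ℝ) →L[ℝ] (ι → ℝ)) ∞ B x₀ :=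
    ((ContinuousLinearMap.compL ℝ (ι → ℝ) G (ι → ℝ) L').contMDiff.contMDiffAt).comp x₀ hA
  have hB0 : B x₀ = ((1 : ((ι → ℝ) →L[ℝ] (ι → ℝ))ˣ) : (ι → ℝ) →L[ℝ] (ι → ℝ)) := by
    ext1 v
    exact LinearMap.congr_fun hL v
  have hinv : ContMDiffAt I 𝓘(ℝ, (ι → ℝ) →L[ℝ] (ι → ℝ)) ∞ (fun x => Ring.inverse (B x)) x₀ := by
    have h1 : ContMDiffAt 𝓘(ℝ, (ι → ℝ) →L[ℝ] (ι → ℝ)) 𝓘(ℝ, (ι → ℝ) →L[ℝ] (ι → ℝ)) ∞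
        Ring.inverse (B x₀) := by
      rw [hB0]
      exact (contDiffAt_ringInverse ℝ 1).contMDiffAt
    exact h1.comp x₀ hB
  have hLt : ContMDiffAt I 𝓘(ℝ, ι → ℝ) ∞ (fun x => L' (t x)) x₀ :=
    L'.contMDiff.contMDiffAt.comp x₀ ht
  have hres : ContMDiffAt I 𝓘(ℝ, ι → ℝ) ∞ (fun x => Ring.inverse (B x) (L' (t x))) x₀ :=
    hinv.clm_apply hLt
  have hunit : ∀ᶠ x in 𝓝 x₀, IsUnit (B x) := by
    apply hB.continuousAt.eventually
    rw [hB0]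
    exact Units.isOpen.mem_nhds (Units.isUnit 1)
  have heq : (c i) =ᶠ[𝓝 x₀] fun x => Ring.inverse (B x) (L' (t x)) i := by
    filter_upwards [h, hunit] with x hx hu
    have : L' (t x) = B x fun j => c j x := by
      change _ = L' (A x _)
      rw [hAapp, hx]
    rw [this, ← mul_apply_eq_comp, Ring.inverse_mul_cancel _ hu]
    rfl
  exact ((e i).contMDiff.contMDiffAt.comp x₀ hres).congr_of_eventuallyEq heq

theorem contMDiff_cutoff_smul {ψ : C^∞⟮I, M; ℝ⟯} {s : Set M} (hψ : tsupport ψ ⊆ s) {f : M → ℝ}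
    (hf : ∀ x ∈ s, ContMDiffAt I 𝓘(ℝ, ℝ) ∞ f x) :
    ContMDiff I 𝓘(ℝ, ℝ) ∞ fun x => ψ x * f x := by
  refine contMDiff_of_tsupport fun x hx => ?_
  exact ψ.contMDiff.contMDiffAt.mul (hf x (hψ (tsupport_mul_subset_left hx)))

variable {FE : Type*} [NormedAddCommGroup FE] [NormedSpace ℝ FE]
  {E : M → Type*} [TopologicalSpace (TotalSpace FE E)] [∀ x, TopologicalSpace (E x)]
  [∀ x, AddCommGroup (E x)] [∀ x, Module ℝ (E x)] [FiberBundle FE E] [VectorBundle ℝ FE E]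

theorem contMDiff_cutoff_section {ψ : C^∞⟮I, M; ℝ⟯} {s : Set M} (hψ : tsupport ψ ⊆ s)
    {a : ∀ x, E x}
    (ha : ∀ x ∈ s, ContMDiffAt I (I.prod 𝓘(ℝ, FE)) ∞ (fun y => TotalSpace.mk' FE y (a y)) x) :
    ContMDiff I (I.prod 𝓘(ℝ, FE)) ∞ fun x => TotalSpace.mk' FE x (ψ x • a x) := by
  intro x
  by_cases hx : x ∈ tsupport ψ
  · exact ψ.contMDiff.contMDiffAt.smul_section (ha x (hψ hx))
  · have h0 : ∀ᶠ y in 𝓝 x, ψ y = 0 := notMem_tsupport_iff_eventuallyEq.1 hx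
    have hz : ContMDiffAt I (I.prod 𝓘(ℝ, FE)) ∞
        (fun y => TotalSpace.mk' FE y (0 : E y)) x := (contMDiff_zeroSection ℝ E).contMDiffAt
    refine hz.congr_of_eventuallyEq ?_
    filter_upwards [h0] with y hy
    simp [hy]

variable [FiniteDimensional ℝ EM] [IsManifold I ∞ M] [T2Space M]

/-- Smooth cutoff functions. -/
theorem exists_cutoff {x₀ : M} {s : Set M} (hs : s ∈ 𝓝 x₀) :
    ∃ ψ : C^∞⟮I, M; ℝ⟯, (∀ᶠ x in 𝓝 x₀, ψ x = 1) ∧ tsupport ψ ⊆ s := by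
  obtain ⟨f, hf, -⟩ := (SmoothBumpFunction.nhds_basis_support (I := I) hs).mem_iff.1 hs
  exact ⟨⟨f, f.contMDiff⟩, f.eventuallyEq_one, hf⟩

/-- The germ of a smooth function extends to a global smooth function. -/
theorem exists_contMDiffMap_eventuallyEq {x₀ : M} {f : M → ℝ}
    (hf : ∀ᶠ x in 𝓝 x₀, ContMDiffAt I 𝓘(ℝ, ℝ) ∞ f x) :
    ∃ g : C^∞⟮I, M; ℝ⟯, ∀ᶠ x in 𝓝 x₀, g x = f x := by
  obtain ⟨ψ, h1, h2⟩ := exists_cutoff (I := I) hf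
  refine ⟨⟨_, contMDiff_cutoff_smul h2 (fun x hx => hx)⟩, ?_⟩
  filter_upwards [h1] with x hx
  simp [hx]

end Frames

/-! ### Local frames of subbundles and the Riesz representation -/

section Subbundles

variable {EM : Type*} [NormedAddCommGroup EM] [NormedSpace ℝ EM]
  {HM : Type*} [TopologicalSpace HM] {I : ModelWithCorners ℝ EM HM}
  {M : Type*} [TopologicalSpace M] [ChartedSpace HM M]
  {FE : Type*} [NormedAddCommGroup FE] [NormedSpace ℝ FE]
  {E : M → Type*} [TopologicalSpace (TotalSpace FE E)] [∀ x, TopologicalSpace (E x)]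
  [∀ x, AddCommGroup (E x)] [∀ x, Module ℝ (E x)] [FiberBundle FE E] [VectorBundle ℝ FE E]

theorem contMDiffSection_sum_apply {ι : Type*} (t : Finset ι) (s : ι → Cₛ^∞⟮I; FE, E⟯) (x : M) :
    (∑ i ∈ t, s i) x = ∑ i ∈ t, s i x := by
  classical
  induction t using Finset.induction_on with
  | empty => rfl
  | insert i t hi ih =>
    rw [Finset.sum_insert hi, Finset.sum_insert hi, ← ih]
    rfl

@[simp]
theorem funSmul_apply (f : C^∞⟮I, M; ℝ⟯) (a : Cₛ^∞⟮I; FE, E⟯) (x : M) :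
    funSmul f a x = f x • a x := rfl

/-- Sections of `V` whose values form a basis of `V` near `x₀`. -/
structure IsFrameAt (V : ∀ x, Submodule ℝ (E x)) {r : ℕ} (e : Fin r → Cₛ^∞⟮I; FE, E⟯)
    (x₀ : M) : Prop where
  mem : ∀ i x, e i x ∈ V x
  frame : ∀ᶠ x in 𝓝 x₀, LinearIndependent ℝ (fun i => e i x) ∧
    Submodule.span ℝ (Set.range fun i => e i x) = V x

namespace IsFrameAt

variable {V : ∀ x, Submodule ℝ (E x)} {r : ℕ} {e : Fin r → Cₛ^∞⟮I; FE, E⟯} {x₀ : M}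

theorem nearby (h : IsFrameAt V e x₀) : ∀ᶠ x in 𝓝 x₀, IsFrameAt V e x :=
  h.frame.eventually_nhds.mono fun _ hx => ⟨h.mem, hx⟩

theorem exists_coeff (h : IsFrameAt V e x₀) {u : E x₀} (hu : u ∈ V x₀) :
    ∃ c : Fin r → ℝ, u = ∑ i, c i • e i x₀ := by
  rw [← h.frame.self_of_nhds.2, Submodule.mem_span_range_iff_exists_fun] at hu
  obtain ⟨c, hc⟩ := hu
  exact ⟨c, hc.symm⟩

theorem finrank_eq (h : IsFrameAt V e x₀) : Module.finrank ℝ (V x₀) = r := by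
  obtain ⟨h1, h2⟩ := h.frame.self_of_nhds
  rw [← h2, finrank_span_eq_card h1, Fintype.card_fin]

/-- A section of `V` through a given vector. -/
theorem exists_section (h : IsFrameAt V e x₀) {u : E x₀} (hu : u ∈ V x₀) :
    ∃ a : Cₛ^∞⟮I; FE, E⟯, (∀ x, a x ∈ V x) ∧ a x₀ = u := by
  obtain ⟨c, rfl⟩ := h.exists_coeff hu
  refine ⟨∑ i, c i • e i, fun x => ?_, ?_⟩
  · rw [contMDiffSection_sum_apply]
    exact Submodule.sum_mem _ fun i _ => Submodule.smul_mem _ _ (h.mem i x)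
  · rw [contMDiffSection_sum_apply]
    rfl

theorem linearIndependent_coord {x : M} (hx : x ∈ (trivializationAt FE E x₀).baseSet)
    {ι : Type*} {v : ι → E x} (hv : LinearIndependent ℝ v) :
    LinearIndependent ℝ fun i => (trivializationAt FE E x₀ ⟨x, v i⟩).2 := by
  have := hv.map' ((trivializationAt FE E x₀).linearEquivAt ℝ x hx).toLinearMap
    (LinearEquiv.ker _)
  exact this

theorem coord_sum {x : M} (hx : x ∈ (trivializationAt FE E x₀).baseSet)
    {ι : Type*} [Fintype ι] (c : ι → ℝ) (v : ι → E x) :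
    (trivializationAt FE E x₀ ⟨x, ∑ i, c i • v i⟩).2
      = ∑ i, c i • (trivializationAt FE E x₀ ⟨x, v i⟩).2 := by
  have h : ∀ u : E x, (trivializationAt FE E x₀ ⟨x, u⟩).2
      = (trivializationAt FE E x₀).linearEquivAt ℝ x hx u := fun u => rfl
  simp only [h, map_sum, map_smul]

variable [FiniteDimensional ℝ FE]

/-- The coefficient functions of a smooth section in a frame are smooth. -/
theorem contMDiffAt_coeff (h : IsFrameAt V e x₀) {a : Cₛ^∞⟮I; FE, E⟯} {c : Fin r → M → ℝ}
    (hc : ∀ᶠ x in 𝓝 x₀, a x = ∑ i, c i x • e i x) (i : Fin r) :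
    ContMDiffAt I 𝓘(ℝ, ℝ) ∞ (c i) x₀ := by
  refine _root_.contMDiffAt_coeff (G := FE)
    (w := fun i x => (trivializationAt FE E x₀ ⟨x, e i x⟩).2)
    (t := fun x => (trivializationAt FE E x₀ ⟨x, a x⟩).2) (c := c) ?_ ?_ ?_ ?_ i
  · exact fun i => (contMDiffAt_section x₀).1 (e i).contMDiff.contMDiffAt
  · exact (contMDiffAt_section x₀).1 a.contMDiff.contMDiffAt
  · exact linearIndependent_coord (mem_baseSet_trivializationAt FE E x₀) h.frame.self_of_nhds.1
  · filter_upwards [hc, (trivializationAt FE E x₀).open_baseSet.mem_nhds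
      (mem_baseSet_trivializationAt FE E x₀)] with x hx hb
    rw [hx, coord_sum hb]

variable [FiniteDimensional ℝ EM] [IsManifold I ∞ M] [T2Space M]

/-- A section of `V` is near `x₀` a combination of the frame with smooth coefficients. -/
theorem exists_contMDiff_coeff (h : IsFrameAt V e x₀) {a : Cₛ^∞⟮I; FE, E⟯}
    (ha : ∀ᶠ x in 𝓝 x₀, a x ∈ V x) :
    ∃ c : Fin r → C^∞⟮I, M; ℝ⟯, ∀ᶠ x in 𝓝 x₀, a x = ∑ i, c i x • e i x := by
  classical
  -- The coefficients are chosen pointwise at all points, with the junk value `0` where `e` is not a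
  -- frame; uniqueness in the frame makes them smooth near `x₀`.
  have hex : ∀ x, ∃ c : Fin r → ℝ, IsFrameAt V e x → a x ∈ V x → a x = ∑ i, c i • e i x := by
    intro x
    by_cases hx : IsFrameAt V e x ∧ a x ∈ V x
    · obtain ⟨c, hc⟩ := hx.1.exists_coeff hx.2
      exact ⟨c, fun _ _ => hc⟩
    · exact ⟨0, fun h1 h2 => absurd ⟨h1, h2⟩ hx⟩
  choose c hc using hex
  have hc' : ∀ᶠ x in 𝓝 x₀, a x = ∑ i, c x i • e i x := by
    filter_upwards [h.nearby, ha] with x hx hax using hc x hx hax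
  have hsm : ∀ i, ∀ᶠ x in 𝓝 x₀, ContMDiffAt I 𝓘(ℝ, ℝ) ∞ (fun y => c y i) x := by
    intro i
    filter_upwards [h.nearby, hc'.eventually_nhds] with x hx hcx
    exact hx.contMDiffAt_coeff (c := fun i y => c y i) hcx i
  choose g hg using fun i => exists_contMDiffMap_eventuallyEq (hsm i)
  refine ⟨g, ?_⟩
  filter_upwards [hc', Filter.eventually_all.2 hg] with x hx hgx
  simp only [hgx, hx]

end IsFrameAt

variable [FiniteDimensional ℝ EM] [IsManifold I ∞ M] [T2Space M]

/-- The sections in `IsSmoothSubbundle` need not lie in `V` away from `x₀`. Multiplying by a cutoff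
function supported where they do makes them global sections of `V` and leaves them unchanged near
`x₀`. -/
theorem IsSmoothSubbundle.exists_frame {V : ∀ x, Submodule ℝ (E x)}
    (hV : IsSmoothSubbundle I FE V) (x₀ : M) :
    ∃ (r : ℕ) (e : Fin r → Cₛ^∞⟮I; FE, E⟯), IsFrameAt V e x₀ := by
  obtain ⟨r, s, hs⟩ := hV x₀
  obtain ⟨ψ, h1, h2⟩ := exists_cutoff (I := I) hs
  refine ⟨r, fun i => funSmul ψ (s i), ?_, ?_⟩
  · intro i x
    by_cases hx : x ∈ tsupport ψ
    · obtain ⟨-, h⟩ := h2 hx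
      rw [funSmul_apply, ← h]
      exact Submodule.smul_mem _ _ (Submodule.subset_span ⟨i, rfl⟩)
    · rw [funSmul_apply, image_eq_zero_of_notMem_tsupport hx, zero_smul]
      exact zero_mem _
  · filter_upwards [hs, h1] with x hx hx1
    simpa [hx1] using hx

theorem IsSmoothSubbundle.exists_section {V : ∀ x, Submodule ℝ (E x)}
    (hV : IsSmoothSubbundle I FE V) {x₀ : M} {u : E x₀} (hu : u ∈ V x₀) :
    ∃ a : Cₛ^∞⟮I; FE, E⟯, (∀ x, a x ∈ V x) ∧ a x₀ = u := by
  obtain ⟨r, e, h⟩ := hV.exists_frame x₀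
  exact h.exists_section hu

theorem IsSmoothSubbundle.finiteDimensional {V : ∀ x, Submodule ℝ (E x)}
    (hV : IsSmoothSubbundle I FE V) (x : M) : FiniteDimensional ℝ (V x) := by
  obtain ⟨r, e, h⟩ := hV.exists_frame x
  rw [← h.frame.self_of_nhds.2]
  exact FiniteDimensional.span_of_finite ℝ (Set.finite_range _)

/-- Riesz representation along a subbundle on which the pairing is nondegenerate. -/
theorem CourantAlgebroid.exists_riesz (C : CourantAlgebroid I FE E) {V : ∀ x, Submodule ℝ (E x)}
    (hV : IsGeneralizedPseudometric C V) (l : ∀ x, E x →ₗ[ℝ] ℝ)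
    (hl : ∀ w : Cₛ^∞⟮I; FE, E⟯, ContMDiff I 𝓘(ℝ, ℝ) ∞ fun x => l x (w x)) :
    ∃ p : Cₛ^∞⟮I; FE, E⟯, ∀ x, p x ∈ V x ∧ ∀ u ∈ V x, C.pairing x (p x) u = l x u := by
  have hex : ∀ x, ∃ p : E x, p ∈ V x ∧ ∀ u ∈ V x, C.pairing x p u = l x u := by
    intro x
    have := hV.subbundle.finiteDimensional x
    let B : V x →ₗ[ℝ] Module.Dual ℝ (V x) := (C.pairing x).restrict (V x)
    have hB : Function.Injective B := by
      rw [injective_iff_map_eq_zero]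
      intro u hu
      apply Subtype.ext
      exact hV.nondegenerate x u u.2 fun v hv => LinearMap.congr_fun hu ⟨v, hv⟩
    have hsurj : Function.Surjective B :=
      (LinearMap.injective_iff_surjective_of_finrank_eq_finrank
        (Subspace.dual_finrank_eq (K := ℝ) (V := V x)).symm).1 hB
    obtain ⟨p, hp⟩ := hsurj ((l x).comp (V x).subtype)
    exact ⟨p, p.2, fun u hu => LinearMap.congr_fun hp ⟨u, hu⟩⟩
  choose p hp hpl using hex
  refine ⟨⟨p, fun x₀ => ?_⟩, fun x => ⟨hp x, hpl x⟩⟩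
  obtain ⟨r, e, he⟩ := hV.subbundle.exists_frame x₀
  have hc : ∀ x, ∃ c : Fin r → ℝ, IsFrameAt V e x → p x = ∑ i, c i • e i x := by
    intro x
    by_cases hx : IsFrameAt V e x
    · obtain ⟨c, hc⟩ := hx.exists_coeff (hp x)
      exact ⟨c, fun _ => hc⟩
    · exact ⟨0, fun h => absurd h hx⟩
  choose c hc using hc
  -- The coefficients of `p` solve the linear system whose vectors are the rows of the Gram matrix
  -- of the frame. These rows are independent because the pairing is nondegenerate on `V`.
  have hsm : ∀ i, ContMDiffAt I 𝓘(ℝ, ℝ) ∞ (fun x => c x i) x₀ := by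
    refine contMDiffAt_coeff (G := Fin r → ℝ) (w := fun i x j => C.pairing x (e i x) (e j x))
      (t := fun x j => l x (e j x)) (c := fun i x => c x i) ?_ ?_ ?_ ?_
    · exact fun i => contMDiffAt_pi_space.2 fun j => (C.pairing_smooth (e i) (e j)).contMDiffAt
    · exact contMDiffAt_pi_space.2 fun j => (hl (e j)).contMDiffAt
    · rw [Fintype.linearIndependent_iff]
      intro g hg
      apply Fintype.linearIndependent_iff.1 he.frame.self_of_nhds.1 g
      apply hV.nondegenerate x₀ _ (Submodule.sum_mem _ fun i _ =>
        Submodule.smul_mem _ _ (he.mem i x₀))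
      intro v hv
      obtain ⟨d, rfl⟩ := he.exists_coeff hv
      rw [map_sum]
      refine Finset.sum_eq_zero fun j _ => ?_
      have := congrFun hg j
      simp only [Finset.sum_apply, Pi.smul_apply, smul_eq_mul, Pi.zero_apply] at this
      rw [map_smul, map_sum, LinearMap.sum_apply]
      simp [this]
    · filter_upwards [he.nearby] with x hx
      funext j
      rw [← hpl x _ (he.mem j x), hc x hx]
      simp
  have : ContMDiffAt I (I.prod 𝓘(ℝ, FE)) ∞
      (fun x => TotalSpace.mk' FE x (∑ i, c x i • e i x)) x₀ :=
    .sum_section fun i _ => (hsm i).smul_section (e i).contMDiff.contMDiffAt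
  refine this.congr_of_eventuallyEq ?_
  filter_upwards [he.nearby] with x hx
  rw [hc x hx]

variable [FiniteDimensional ℝ FE]

/-- The whole bundle is a smooth subbundle. -/
theorem isSmoothSubbundle_top [ContMDiffVectorBundle ∞ FE E I] :
    IsSmoothSubbundle I FE (fun x => (⊤ : Submodule ℝ (E x))) := by
  intro x₀
  let t := trivializationAt FE E x₀
  let b := Module.finBasis ℝ FE
  have hfr := t.isLocalFrameOn_localFrame_baseSet I ∞ b
  have ht : t.baseSet ∈ 𝓝 x₀ := t.open_baseSet.mem_nhds (mem_baseSet_trivializationAt FE E x₀)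
  obtain ⟨ψ, h1, h2⟩ := exists_cutoff (I := I) ht
  refine ⟨_, fun i => ⟨_, contMDiff_cutoff_section (a := t.localFrame b i) h2 fun x hx =>
    hfr.contMDiffAt t.open_baseSet hx i⟩, ?_⟩
  filter_upwards [h1, ht] with x hx hxt
  have e1 : (fun i => (⟨fun x => ψ x • t.localFrame b i x,
      contMDiff_cutoff_section (a := t.localFrame b i) h2 fun x hx =>
        hfr.contMDiffAt t.open_baseSet hx i⟩ : Cₛ^∞⟮I; FE, E⟯) x)
      = fun i => t.localFrame b i x := by
    funext i
    change ψ x • t.localFrame b i x = _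
    rw [hx, one_smul]
  rw [e1]
  exact ⟨hfr.linearIndependent hxt, top_le_iff.1 (hfr.generating hxt)⟩

end Subbundles

/-! ### Linear differential equations along right translations of a Lie group -/

section LieGroupODE

variable {ES : Type*} [NormedAddCommGroup ES] [NormedSpace ℝ ES] [FiniteDimensional ℝ ES]
  {HS : Type*} [TopologicalSpace HS] {IS : ModelWithCorners ℝ ES HS} [IS.Boundaryless]
  {S : Type*} [TopologicalSpace S] [ChartedSpace HS S] [Group S] [LieGroup IS ∞ S]
  {Y : Type*} [NormedAddCommGroup Y] [NormedSpace ℝ Y]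

/-- A function with `f 0 = 0` near which `‖df‖ ≤ C ‖f‖` vanishes near the point. -/
theorem eventually_eq_zero_of_norm_fderiv_le {f : ES → Y} {w₀ : ES} {C : ℝ}
    (hf : ∀ᶠ w in 𝓝 w₀, DifferentiableAt ℝ f w ∧ ∀ v, ‖fderiv ℝ f w v‖ ≤ C * ‖v‖ * ‖f w‖)
    (h0 : f w₀ = 0) : ∀ᶠ w in 𝓝 w₀, f w = 0 := by
  obtain ⟨ε, hε, hb⟩ := Metric.eventually_nhds_iff_ball.1 hf
  filter_upwards [Metric.ball_mem_nhds w₀ hε] with w hw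
  have hmem : ∀ t ∈ Set.Icc (0 : ℝ) 1, w₀ + t • (w - w₀) ∈ Metric.ball w₀ ε := by
    intro t ht
    rw [Metric.mem_ball, dist_eq_norm] at hw ⊢
    rw [add_sub_cancel_left, norm_smul, Real.norm_of_nonneg ht.1]
    exact lt_of_le_of_lt (mul_le_of_le_one_left (norm_nonneg _) ht.2) hw
  have hder : ∀ t ∈ Set.Icc (0 : ℝ) 1, HasDerivAt (fun t : ℝ => f (w₀ + t • (w - w₀)))
      (fderiv ℝ f (w₀ + t • (w - w₀)) (w - w₀)) t := by
    intro t ht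
    have h1 : HasDerivAt (fun t : ℝ => w₀ + t • (w - w₀)) (w - w₀) t := by
      simpa using ((hasDerivAt_id t).smul_const (w - w₀)).const_add w₀
    exact (hb _ (hmem t ht)).1.hasFDerivAt.comp_hasDerivAt t h1
  -- Grönwall's inequality on the segment from `w₀` to `w`.
  have := eq_zero_of_abs_deriv_le_mul_abs_self_of_eq_zero_right
    (f := fun t : ℝ => f (w₀ + t • (w - w₀)))
    (f' := fun t => fderiv ℝ f (w₀ + t • (w - w₀)) (w - w₀)) (K := C * ‖w - w₀‖) (a := 0) (b := 1)
    (fun t ht => (hder t ht).continuousAt.continuousWithinAt)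
    (fun t ht => (hder t ⟨ht.1, ht.2.le⟩).hasDerivWithinAt) (by simp [h0])
    (fun t ht => (hb _ (hmem t ⟨ht.1, ht.2.le⟩)).2 _) 1 ⟨zero_le_one, le_rfl⟩
  simpa using this

/-- Bounds along finitely many directions control a linear map in all directions, with a constant
independent of the map. This makes the direction-dependent constants in the differential
inequalities below uniform. -/
theorem exists_norm_apply_le_of_basis {ι : Type*} [Fintype ι] (b : Module.Basis ι ℝ ES)
    (C : ι → ℝ) : ∃ D : ℝ, ∀ (T : ES →L[ℝ] Y) {K : ℝ}, 0 ≤ K → (∀ k, ‖T (b k)‖ ≤ C k * K) →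
      ∀ s, ‖T s‖ ≤ D * ‖s‖ * K := by
  refine ⟨∑ k, |C k| * ‖(b.coord k).toContinuousLinearMap‖, fun T K hK hT s => ?_⟩
  calc ‖T s‖ = ‖∑ k, b.coord k s • T (b k)‖ := by
        conv_lhs => rw [← b.sum_repr s, map_sum]
        simp only [map_smul, Module.Basis.coord_apply]
    _ ≤ ∑ k, ‖b.coord k s • T (b k)‖ := norm_sum_le _ _
    _ ≤ ∑ k, (|C k| * ‖(b.coord k).toContinuousLinearMap‖) * (‖s‖ * K) := by
        refine Finset.sum_le_sum fun k _ => ?_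
        rw [norm_smul]
        have e1 : ‖b.coord k s‖ ≤ ‖(b.coord k).toContinuousLinearMap‖ * ‖s‖ :=
          (b.coord k).toContinuousLinearMap.le_opNorm s
        have e2 : ‖T (b k)‖ ≤ |C k| * K :=
          (hT k).trans (mul_le_mul_of_nonneg_right (le_abs_self _) hK)
        calc _ ≤ (‖(b.coord k).toContinuousLinearMap‖ * ‖s‖) * (|C k| * K) :=
              mul_le_mul e1 e2 (norm_nonneg _) (by positivity)
          _ = _ := by ring
    _ = _ := by rw [← Finset.sum_mul, mul_assoc]

variable (IS) in
/-- The derivative at the identity of a function on a Lie group along `s`. -/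
noncomputable def derivAtOne (y : S → Y) (s : GroupLieAlgebra IS S) : Y :=
  mfderiv IS 𝓘(ℝ, Y) y 1 s

theorem derivAtOne_clm_comp {Z : Type*} [NormedAddCommGroup Z] [NormedSpace ℝ Z] (T : Y →L[ℝ] Z)
    {y : S → Y} (hy : ContMDiff IS 𝓘(ℝ, Y) ∞ y) (s : GroupLieAlgebra IS S) :
    derivAtOne IS (fun h => T (y h)) s = T (derivAtOne IS y s) :=
  congrArg (fun D : ES →L[ℝ] Z => D s) ((T.hasMFDerivAt (x := y 1)).comp (1 : S)
    (hy.mdifferentiable (by simp) 1).hasMFDerivAt).mfderiv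

theorem derivAtOne_sub {y z : S → Y} (hy : ContMDiff IS 𝓘(ℝ, Y) ∞ y)
    (hz : ContMDiff IS 𝓘(ℝ, Y) ∞ z) (s : GroupLieAlgebra IS S) :
    derivAtOne IS (fun h => y h - z h) s = derivAtOne IS y s - derivAtOne IS z s :=
  congrArg (fun D : ES →L[ℝ] Y => D s) ((hy.mdifferentiable (by simp) 1).hasMFDerivAt.sub
    (hz.mdifferentiable (by simp) 1).hasMFDerivAt).mfderiv

theorem derivAtOne_const (c : Y) (s : GroupLieAlgebra IS S) :
    derivAtOne IS (fun _ : S => c) s = 0 :=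
  congrArg (fun D : ES →L[ℝ] Y => D s) (hasMFDerivAt_const c (1 : S)).mfderiv

theorem derivAtOne_bilin {Y₁ Y₂ : Type*} [NormedAddCommGroup Y₁] [NormedSpace ℝ Y₁]
    [NormedAddCommGroup Y₂] [NormedSpace ℝ Y₂] (B : Y₁ →L[ℝ] Y₂ →L[ℝ] Y) {y : S → Y₁} {z : S → Y₂}
    (hy : ContMDiff IS 𝓘(ℝ, Y₁) ∞ y) (hz : ContMDiff IS 𝓘(ℝ, Y₂) ∞ z) (s : GroupLieAlgebra IS S) :
    derivAtOne IS (fun h => B (y h) (z h)) s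
      = B (y 1) (derivAtOne IS z s) + B (derivAtOne IS y s) (z 1) := by
  have h12 : ContMDiff IS 𝓘(ℝ, Y₁ × Y₂) ∞ fun h => (y h, z h) := hy.prodMk_space hz
  have hp := (h12.mdifferentiable (by simp) 1).hasMFDerivAt
  have h1 := derivAtOne_clm_comp (ContinuousLinearMap.fst ℝ Y₁ Y₂) h12 s
  have h2 := derivAtOne_clm_comp (ContinuousLinearMap.snd ℝ Y₁ Y₂) h12 s
  have h3 := (HasFDerivAt.hasMFDerivAt
    (B.isBoundedBilinearMap.hasFDerivAt (y 1, z 1))).comp (1 : S) hp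
  simp only [ContinuousLinearMap.coe_fst', ContinuousLinearMap.coe_snd'] at h1 h2
  rw [h1, h2]
  exact congrArg (fun D : ES →L[ℝ] Y => D s) h3.mfderiv

/-- Uniqueness for linear differential equations along the right translations of a Lie group. -/
theorem eventually_eq_zero_of_mfderiv_mul_le {y : S → Y} (hy : ContMDiff IS 𝓘(ℝ, Y) ∞ y)
    (h : ∀ s : GroupLieAlgebra IS S, ∃ C : ℝ, ∀ᶠ g in 𝓝 (1 : S),
      ‖derivAtOne IS (fun h => y (h * g)) s‖ ≤ C * ‖y g‖)
    (h1 : y 1 = 0) : ∀ᶠ g in 𝓝 (1 : S), y g = 0 := by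
  let φ := extChartAt IS (1 : S)
  let w₀ : ES := φ 1
  let f : ES → Y := fun w => y (φ.symm w)
  have hφw₀ : φ.symm w₀ = 1 := extChartAt_to_inv (I := IS) (1 : S)
  have htarget : φ.target ∈ 𝓝 w₀ := extChartAt_target_mem_nhds (I := IS) (1 : S)
  have hsymm : ∀ w ∈ φ.target, ContMDiffAt 𝓘(ℝ, ES) IS ∞ φ.symm w := fun w hw =>
    (contMDiffOn_extChartAt_symm (I := IS) (n := ∞) (1 : S)).contMDiffAt
      ((isOpen_extChartAt_target (I := IS) (1 : S)).mem_nhds hw)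
  have hw₀ : w₀ ∈ φ.target := mem_of_mem_nhds htarget
  -- With `g = φ.symm w`, the chart expression of `y` is `h ↦ y (h * g)` composed with `κ w`, and `κ
  -- w w = 1`. So its derivative at `w` is the derivative at `1` along right translation by `g`,
  -- which the hypothesis bounds, composed with `L w`.
  let κ : ES → ES → S := fun w w' => φ.symm w' * (φ.symm w)⁻¹
  have hκ1 : ∀ w, κ w w = 1 := fun w => mul_inv_cancel _
  -- the derivative of right translation back to `1`, in the chart
  have hH : ContDiffAt ℝ ∞ (Function.uncurry fun w w' => φ (κ w w')) (w₀, w₀) := by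
    have h2 : ContMDiffAt (𝓘(ℝ, ES).prod 𝓘(ℝ, ES)) IS ∞
        (fun p : ES × ES => φ.symm p.2 * (φ.symm p.1)⁻¹) (w₀, w₀) :=
      ((hsymm w₀ hw₀).comp (w₀, w₀) contMDiffAt_snd).mul
        ((hsymm w₀ hw₀).comp (w₀, w₀) contMDiffAt_fst).inv
    have h3 : ContMDiffAt IS 𝓘(ℝ, ES) ∞ φ (φ.symm w₀ * (φ.symm w₀)⁻¹) := by
      rw [mul_inv_cancel]
      exact contMDiffAt_extChartAt
    have h4 := h3.comp (w₀, w₀) h2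
    rw [← modelWithCornersSelf_prod, chartedSpaceSelf_prod] at h4
    exact h4.contDiffAt
  let L : ES → ES →L[ℝ] ES := fun w => fderiv ℝ (fun w' => φ (κ w w')) w
  -- Joint smoothness in both variables makes `L` continuous, hence bounded near `w₀`.
  have hL : ContinuousAt L w₀ :=
    (ContDiffAt.fderiv (m := 0) (g := id) hH contDiffAt_id (by simp)).continuousAt
  obtain ⟨B, hB⟩ : ∃ B : ℝ, ∀ᶠ w in 𝓝 w₀, ‖L w‖ ≤ B :=
    ⟨‖L w₀‖ + 1, hL.norm.eventually_le_const (lt_add_one _)⟩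
  let b := Module.finBasis ℝ ES
  choose C hC using fun k => h (b k)
  obtain ⟨D, hDb⟩ := exists_norm_apply_le_of_basis (Y := Y) b C
  have hD : ∀ᶠ g in 𝓝 (1 : S), ∀ s : ES,
      ‖derivAtOne IS (fun h => y (h * g)) s‖ ≤ D * ‖s‖ * ‖y g‖ := by
    filter_upwards [Filter.eventually_all.2 hC] with g hg s
    exact hDb (mfderiv IS 𝓘(ℝ, Y) (fun h => y (h * g)) 1) (norm_nonneg _) hg s
  have hφ : Filter.Tendsto φ.symm (𝓝 w₀) (𝓝 1) := by
    have := (hsymm w₀ hw₀).continuousAt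
    rwa [ContinuousAt, hφw₀] at this
  have hf : ∀ᶠ w in 𝓝 w₀, f w = 0 := by
    refine eventually_eq_zero_of_norm_fderiv_le (C := |D| * |B|) ?_ (by simp [f, hφw₀, h1])
    filter_upwards [htarget, hB, hφ.eventually hD] with w hw hBw hDw
    have hκd : ContMDiffAt 𝓘(ℝ, ES) IS ∞ (κ w) w := (hsymm w hw).mul contMDiffAt_const
    have hκm : HasMFDerivAt 𝓘(ℝ, ES) IS (κ w) w (L w) := by
      have h3 : ContMDiffAt IS 𝓘(ℝ, ES) ∞ φ (κ w w) := by
        rw [hκ1]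
        exact contMDiffAt_extChartAt
      have h5 : HasFDerivAt (fun w' => φ (κ w w')) (L w) w :=
        ((h3.comp w hκd).contDiffAt.differentiableAt (by simp)).hasFDerivAt
      refine ⟨hκd.continuousAt, ?_⟩
      have h6 : writtenInExtChartAt 𝓘(ℝ, ES) IS w (κ w) = fun w' => φ (κ w w') := by
        funext w'
        simp only [writtenInExtChartAt, hκ1]
        rfl
      rw [h6]
      exact h5.hasFDerivWithinAt
    have hyd : HasMFDerivAt IS 𝓘(ℝ, Y) (fun h => y (h * φ.symm w)) (κ w w)
        (mfderiv IS 𝓘(ℝ, Y) (fun h => y (h * φ.symm w)) (κ w w)) := by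
      have : ContMDiff IS 𝓘(ℝ, Y) ∞ (fun h => y (h * φ.symm w)) :=
        hy.comp (contMDiff_id.mul contMDiff_const)
      exact (this.mdifferentiable (by simp) _).hasMFDerivAt
    have hfeq : (fun h => y (h * φ.symm w)) ∘ κ w = f := by
      funext w'
      simp [κ, f]
    let R : ES →L[ℝ] Y := mfderiv IS 𝓘(ℝ, Y) (fun h => y (h * φ.symm w)) (κ w w)
    have hcomp : HasFDerivAt f (R.comp (L w)) w := by
      rw [← hfeq]
      exact hasMFDerivAt_iff_hasFDerivAt.1 (hyd.comp w hκm)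
    refine ⟨hcomp.differentiableAt, fun v => ?_⟩
    rw [hcomp.fderiv]
    have h7 := hDw (L w v)
    unfold derivAtOne at h7
    rw [← hκ1 w] at h7
    refine h7.trans ?_
    have h8 : ‖L w v‖ ≤ |B| * ‖v‖ := ((L w).le_opNorm v).trans
      (mul_le_mul_of_nonneg_right (hBw.trans (le_abs_self B)) (norm_nonneg _))
    refine mul_le_mul_of_nonneg_right ?_ (norm_nonneg _)
    calc D * ‖L w v‖ ≤ |D| * (|B| * ‖v‖) :=
          mul_le_mul (le_abs_self D) h8 (norm_nonneg _) (abs_nonneg _)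
      _ = _ := by ring
  have hback : Filter.Tendsto φ (𝓝 1) (𝓝 w₀) := continuousAt_extChartAt (I := IS) (1 : S)
  filter_upwards [hback.eventually hf, extChartAt_source_mem_nhds (I := IS) (1 : S)] with g hg hgs
  have : φ.symm (φ g) = g := φ.left_inv hgs
  simpa [f, this] using hg

/-- The same for a finite family of functions. -/
theorem eventually_eq_zero_of_mfderiv_mul_le_sum {ι : Type*} [Fintype ι] {y : ι → S → Y}
    (hy : ∀ i, ContMDiff IS 𝓘(ℝ, Y) ∞ (y i))
    (h : ∀ (s : GroupLieAlgebra IS S) (i : ι), ∃ C : ℝ, ∀ᶠ g in 𝓝 (1 : S),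
      ‖derivAtOne IS (fun h => y i (h * g)) s‖ ≤ C * ∑ j, ‖y j g‖)
    (h1 : ∀ i, y i 1 = 0) : ∀ᶠ g in 𝓝 (1 : S), ∀ i, y i g = 0 := by
  classical
  have hY : ContMDiff IS 𝓘(ℝ, ι → Y) ∞ (fun g i => y i g) := contMDiff_pi_space.2 hy
  have key := eventually_eq_zero_of_mfderiv_mul_le (y := fun g i => y i g) hY ?_ (funext h1)
  · filter_upwards [key] with g hg i using congrFun hg i
  intro s
  choose C hC using h s
  refine ⟨(∑ i, |C i|) * Fintype.card ι, ?_⟩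
  filter_upwards [Filter.eventually_all.2 hC] with g hg
  have hYg : ContMDiff IS 𝓘(ℝ, ι → Y) ∞ (fun h i => y i (h * g)) :=
    hY.comp (contMDiff_id.mul contMDiff_const)
  have hcard : ∑ j, ‖y j g‖ ≤ Fintype.card ι * ‖fun i => y i g‖ := by
    calc _ ≤ ∑ _j : ι, ‖fun i => y i g‖ :=
          Finset.sum_le_sum fun j _ => norm_le_pi_norm (fun i => y i g) j
      _ = _ := by simp
  have hnn : 0 ≤ ∑ j, ‖y j g‖ := Finset.sum_nonneg fun _ _ => norm_nonneg _
  change ‖derivAtOne IS (fun h i => y i (h * g)) s‖ ≤ _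
  rw [pi_norm_le_iff_of_nonneg (by positivity)]
  intro i
  have e := derivAtOne_clm_comp (ContinuousLinearMap.proj (R := ℝ) (φ := fun _ : ι => Y) i) hYg s
  change derivAtOne IS (fun h => y i (h * g)) s = derivAtOne IS (fun h i => y i (h * g)) s i at e
  rw [← e]
  refine (hg i).trans ?_
  calc C i * ∑ j, ‖y j g‖ ≤ (∑ i, |C i|) * ∑ j, ‖y j g‖ := by
        refine mul_le_mul_of_nonneg_right ((le_abs_self _).trans ?_) hnn
        exact Finset.single_le_sum (f := fun i => |C i|) (fun _ _ => abs_nonneg _)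
          (Finset.mem_univ i)
    _ ≤ (∑ i, |C i|) * (Fintype.card ι * ‖fun i => y i g‖) :=
        mul_le_mul_of_nonneg_left hcard (Finset.sum_nonneg fun _ _ => abs_nonneg _)
    _ = _ := by ring

/-- A subset of a connected group that is stable, in both directions, under multiplication by
elements close to `1` is everything. -/
theorem mem_of_eventually_mul_mem_iff {S : Type*} [TopologicalSpace S] [Group S]
    [IsTopologicalGroup S] [ConnectedSpace S] {G : Set S} (h1 : (1 : S) ∈ G)
    (hG : ∀ g, ∀ᶠ h in 𝓝 (1 : S), h * g ∈ G ↔ g ∈ G) (g : S) : g ∈ G := by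
  have key : ∀ g, ∀ᶠ k in 𝓝 g, k ∈ G ↔ g ∈ G := by
    intro g
    have : Filter.Tendsto (fun k => k * g⁻¹) (𝓝 g) (𝓝 1) := by
      have : ContinuousAt (fun k => k * g⁻¹) g := by fun_prop
      simpa [ContinuousAt] using this
    filter_upwards [this.eventually (hG g)] with k hk
    simpa using hk
  have hclopen : IsClopen G := by
    refine ⟨⟨isOpen_iff_mem_nhds.2 fun g hg => ?_⟩, isOpen_iff_mem_nhds.2 fun g hg => ?_⟩
    · filter_upwards [key g] with k hk
      exact fun hk' => hg (hk.1 hk')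
    · filter_upwards [key g] with k hk
      exact hk.2 hg
  rw [hclopen.eq_univ ⟨1, h1⟩]
  trivial

/-- A smooth function on a connected Lie group with vanishing derivative along right translations
is constant. -/
theorem eq_of_mfderiv_mul_eq_zero [ConnectedSpace S] {y : S → Y}
    (hy : ContMDiff IS 𝓘(ℝ, Y) ∞ y)
    (h : ∀ (s : GroupLieAlgebra IS S) (g : S), derivAtOne IS (fun h => y (h * g)) s = 0)
    (g : S) : y g = y 1 := by
  have : IsTopologicalGroup S := topologicalGroup_of_lieGroup IS ∞
  refine mem_of_eventually_mul_mem_iff (G := {g | y g = y 1}) rfl (fun g => ?_) g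
  have hyg : ContMDiff IS 𝓘(ℝ, Y) ∞ (fun h => y (h * g)) :=
    hy.comp (contMDiff_id.mul contMDiff_const)
  -- The difference vanishes at `1` and has zero derivative along right translations, so the
  -- inequality holds with constant `0`.
  have key := eventually_eq_zero_of_mfderiv_mul_le (y := fun h => y (h * g) - y g)
    (hyg.sub contMDiff_const) (fun s => ⟨0, Filter.Eventually.of_forall fun k => ?_⟩) (by simp)
  · filter_upwards [key] with k hk
    rw [sub_eq_zero] at hk
    simp [hk]
  · have h1 : ContMDiff IS 𝓘(ℝ, Y) ∞ (fun h => y (h * (k * g))) :=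
      hy.comp (contMDiff_id.mul contMDiff_const)
    have h3 : (fun h => y (h * k * g) - y g) = fun h => y (h * (k * g)) - y g := by
      simp only [mul_assoc]
    rw [h3, derivAtOne_sub h1 contMDiff_const, derivAtOne_const, h s (k * g)]
    simp

end LieGroupODE

/-! ### Courant algebroid calculus and tensoriality of the Ricci endomorphism -/

section CourantCalculus

variable {EM : Type*} [NormedAddCommGroup EM] [NormedSpace ℝ EM] [FiniteDimensional ℝ EM]
  {HM : Type*} [TopologicalSpace HM] {I : ModelWithCorners ℝ EM HM}
  {M : Type*} [TopologicalSpace M] [ChartedSpace HM M] [IsManifold I ∞ M] [T2Space M]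
  {FE : Type*} [NormedAddCommGroup FE] [NormedSpace ℝ FE] [FiniteDimensional ℝ FE]
  {E : M → Type*} [TopologicalSpace (TotalSpace FE E)] [∀ x, TopologicalSpace (E x)]
  [∀ x, AddCommGroup (E x)] [∀ x, Module ℝ (E x)] [FiberBundle FE E] [VectorBundle ℝ FE E]

theorem exists_section_eq [ContMDiffVectorBundle ∞ FE E I] {x : M} (u : E x) :
    ∃ a : Cₛ^∞⟮I; FE, E⟯, a x = u := by
  obtain ⟨a, -, ha⟩ := (isSmoothSubbundle_top (I := I) (FE := FE) (E := E)).exists_section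
    (Submodule.mem_top (x := u))
  exact ⟨a, ha⟩

/-- An operation on sections of `V` that is linear over smooth functions is pointwise. -/
theorem IsSmoothSubbundle.apply_eq_zero {V : ∀ x, Submodule ℝ (E x)}
    (hV : IsSmoothSubbundle I FE V) (R : Cₛ^∞⟮I; FE, E⟯ →ₗ[ℝ] Cₛ^∞⟮I; FE, E⟯)
    (hR : ∀ (f : C^∞⟮I, M; ℝ⟯) (v : Cₛ^∞⟮I; FE, E⟯), (∀ x, v x ∈ V x) →
      R (funSmul f v) = funSmul f (R v))
    {v : Cₛ^∞⟮I; FE, E⟯} (hv : ∀ x, v x ∈ V x) {x : M} (hx : v x = 0) : R v x = 0 := by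
  obtain ⟨r, e, he⟩ := hV.exists_frame x
  obtain ⟨c, hc⟩ := he.exists_contMDiff_coeff (Filter.Eventually.of_forall hv)
  obtain ⟨ψ, h1, h2⟩ := exists_cutoff (I := I) hc
  have hcx : ∀ i, c i x = 0 := by
    have := hc.self_of_nhds
    rw [hx] at this
    exact Fintype.linearIndependent_iff.1 he.frame.self_of_nhds.1 _ this.symm
  -- The cutoff turns the local frame expansion into an identity of global sections, to which `R`
  -- can be applied. All coefficients vanish at `x`.
  have key : funSmul ψ v = ∑ i, funSmul (ψ * c i) (e i) := by
    ext y
    rw [contMDiffSection_sum_apply]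
    by_cases hy : y ∈ tsupport ψ
    · have hy' : v y = ∑ i, c i y • e i y := h2 hy
      simp only [funSmul_apply]
      rw [hy', Finset.smul_sum]
      exact Finset.sum_congr rfl fun i _ => smul_smul _ _ _
    · have : ψ y = 0 := image_eq_zero_of_notMem_tsupport hy
      simp [this]
  have := congrArg (fun s => R s x) key
  simp only [hR ψ v hv, map_sum, contMDiffSection_sum_apply, funSmul_apply,
    h1.self_of_nhds, one_smul] at this
  rw [this]
  refine Finset.sum_eq_zero fun i _ => ?_
  rw [hR _ _ (he.mem i)]
  simp [hcx i]

/-- A vector is extended to a section of `V`; by `IsSmoothSubbundle.apply_eq_zero` the value of `R`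
at `x` does not depend on the extension, which also yields linearity. -/
theorem IsSmoothSubbundle.exists_end {V : ∀ x, Submodule ℝ (E x)}
    (hV : IsSmoothSubbundle I FE V) (R : Cₛ^∞⟮I; FE, E⟯ →ₗ[ℝ] Cₛ^∞⟮I; FE, E⟯)
    (hR : ∀ (f : C^∞⟮I, M; ℝ⟯) (v : Cₛ^∞⟮I; FE, E⟯), (∀ x, v x ∈ V x) →
      R (funSmul f v) = funSmul f (R v))
    (hRV : ∀ v x, R v x ∈ V x) (x : M) :
    ∃ T : Module.End ℝ (V x), ∀ (v : Cₛ^∞⟮I; FE, E⟯) (hv : ∀ y, v y ∈ V y),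
      (T ⟨v x, hv x⟩ : E x) = R v x := by
  choose s hsV hs using fun u : V x => hV.exists_section u.2
  have key : ∀ {v w : Cₛ^∞⟮I; FE, E⟯}, (∀ y, v y ∈ V y) → (∀ y, w y ∈ V y) → v x = w x →
      R v x = R w x := by
    intro v w hv hw h
    have := hV.apply_eq_zero R hR (v := v - w) (fun y => sub_mem (hv y) (hw y))
      (sub_eq_zero.2 h)
    rw [map_sub] at this
    exact sub_eq_zero.1 this
  refine ⟨{ toFun := fun u => ⟨R (s u) x, hRV _ x⟩, map_add' := ?_, map_smul' := ?_ }, ?_⟩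
  · intro u w
    apply Subtype.ext
    have := key (v := s (u + w)) (w := s u + s w) (hsV (u + w)) (fun y => add_mem (hsV u y) (hsV w y) : ∀ y, (s u + s w) y ∈ V y)
      (by rw [hs]; exact (congrArg₂ (· + ·) (hs u) (hs w)).symm)
    rw [map_add] at this
    exact this
  · intro c u
    apply Subtype.ext
    have := key (v := s (c • u)) (w := c • s u) (hsV (c • u)) (fun y => (V y).smul_mem c (hsV u y) : ∀ y, (c • s u) y ∈ V y)
      (by rw [hs]; exact (congrArg (c • ·) (hs u)).symm)
    rw [map_smul] at this
    exact this
  · intro v hv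
    exact key (hsV _) hv (hs _)

namespace CourantAlgebroid

variable (C : CourantAlgebroid I FE E)

/-- The bracket as a bilinear map. -/
noncomputable def bracketₗ :
    Cₛ^∞⟮I; FE, E⟯ →ₗ[ℝ] Cₛ^∞⟮I; FE, E⟯ →ₗ[ℝ] Cₛ^∞⟮I; FE, E⟯ :=
  LinearMap.mk₂ ℝ C.bracket C.bracket_add_left C.bracket_smul_left C.bracket_add_right
    C.bracket_smul_right

theorem bracket_zero (u : Cₛ^∞⟮I; FE, E⟯) : C.bracket u 0 = 0 := (C.bracketₗ u).map_zero

theorem zero_bracket (u : Cₛ^∞⟮I; FE, E⟯) : C.bracket 0 u = 0 := C.bracketₗ.map_zero₂ u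

theorem bracket_sub (u v w : Cₛ^∞⟮I; FE, E⟯) :
    C.bracket u (v - w) = C.bracket u v - C.bracket u w := (C.bracketₗ u).map_sub v w

theorem sub_bracket (u v w : Cₛ^∞⟮I; FE, E⟯) :
    C.bracket (u - v) w = C.bracket u w - C.bracket v w := C.bracketₗ.map_sub₂ u v w

theorem bracket_sum {ι : Type*} (t : Finset ι) (u : Cₛ^∞⟮I; FE, E⟯) (v : ι → Cₛ^∞⟮I; FE, E⟯) :
    C.bracket u (∑ i ∈ t, v i) = ∑ i ∈ t, C.bracket u (v i) := map_sum (C.bracketₗ u) v t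

theorem contMDiff_act (u : Cₛ^∞⟮I; FE, E⟯) {f : M → ℝ} (hf : ContMDiff I 𝓘(ℝ, ℝ) ∞ f) :
    ContMDiff I 𝓘(ℝ, ℝ) ∞ (C.act u f) := by
  have h1 : ContMDiff I.tangent 𝓘(ℝ, ℝ).tangent ∞ (tangentMap I 𝓘(ℝ, ℝ) f) :=
    hf.contMDiff_tangentMap (by simp)
  have h2 := h1.comp (C.anchor_smooth u)
  exact contMDiff_snd_tangentBundle_modelSpace ℝ 𝓘(ℝ, ℝ) |>.comp h2

/-- `u · f` as a smooth function. -/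
noncomputable def actMap (u : Cₛ^∞⟮I; FE, E⟯) (f : C^∞⟮I, M; ℝ⟯) : C^∞⟮I, M; ℝ⟯ :=
  ⟨C.act u f, C.contMDiff_act u f.contMDiff⟩

/-- `⟨u, v⟩` as a smooth function. -/
noncomputable def pairMap (u v : Cₛ^∞⟮I; FE, E⟯) : C^∞⟮I, M; ℝ⟯ :=
  ⟨C.pair u v, C.pairing_smooth u v⟩

theorem bracket_funSmul (u : Cₛ^∞⟮I; FE, E⟯) (f : C^∞⟮I, M; ℝ⟯) (v : Cₛ^∞⟮I; FE, E⟯) :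
    C.bracket u (funSmul f v) = funSmul f (C.bracket u v) + funSmul (C.actMap u f) v := by
  ext x
  exact C.leibniz u f v x

theorem act_const (u : Cₛ^∞⟮I; FE, E⟯) (c : ℝ) (x : M) : C.act u (fun _ => c) x = 0 := by
  rw [CourantData.act, mfderiv_const]
  rfl

/-- The anchor maps the bracket to the commutator of vector fields. -/
theorem act_bracket [ContMDiffVectorBundle ∞ FE E I] (u v : Cₛ^∞⟮I; FE, E⟯)
    (f : C^∞⟮I, M; ℝ⟯) (x : M) :
    C.act (C.bracket u v) f x = C.act u (C.act v f) x - C.act v (C.act u f) x := by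
  -- Comparing the Jacobi identity for `u, v, f w` with the one for `u, v, w` leaves the asserted
  -- relation times `w x`. This needs a nonzero vector in the fibre; over a zero fibre the anchor
  -- vanishes and all terms are zero.
  by_cases h : ∃ w : E x, w ≠ 0
  · obtain ⟨w₀, hw₀⟩ := h
    obtain ⟨w, rfl⟩ := exists_section_eq (I := I) (FE := FE) w₀
    have hj := congrArg (fun s => s x) (C.jacobi u v (funSmul f w))
    have hj' := congrArg (fun s => s x) (C.jacobi u v w)
    simp only [bracket_funSmul, C.bracket_add_right, ContMDiffSection.coe_add, Pi.add_apply,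
      funSmul_apply] at hj hj'
    have e1 : C.actMap (C.bracket u v) f x = C.act (C.bracket u v) f x := rfl
    have e2 : C.actMap u (C.actMap v f) x = C.act u (C.act v f) x := rfl
    have e3 : C.actMap v (C.actMap u f) x = C.act v (C.act u f) x := rfl
    rw [hj', e1, e2, e3] at hj
    have : (C.act u (C.act v f) x - C.act v (C.act u f) x - C.act (C.bracket u v) f x) • w x
        = 0 := by
      rw [← sub_eq_zero] at hj
      rw [← hj]
      module
    have := (smul_eq_zero.1 this).resolve_right hw₀
    linarith
  · push Not at h
    have hz : ∀ (a : Cₛ^∞⟮I; FE, E⟯) (g : M → ℝ), C.act a g x = 0 := by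
      intro a g
      rw [CourantData.act, h (a x), map_zero]
      exact map_zero (mfderiv I 𝓘(ℝ, ℝ) g x)
    simp [hz]

theorem eq_zero_of_pairing [ContMDiffVectorBundle ∞ FE E I] {x : M} {u : E x}
    (h : ∀ w : Cₛ^∞⟮I; FE, E⟯, C.pairing x (w x) u = 0) : u = 0 := by
  refine C.pairing_nondegenerate x u fun v => ?_
  obtain ⟨w, rfl⟩ := exists_section_eq (I := I) (FE := FE) v
  rw [C.pairing_symm]
  exact h w

/-- The symmetric part of the bracket is `d_E ⟨u, v⟩`, which vanishes when the pairing is constant.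
-/
theorem bracket_swap [ContMDiffVectorBundle ∞ FE E I] {u v : Cₛ^∞⟮I; FE, E⟯} {c : ℝ}
    (h : ∀ x, C.pairing x (u x) (v x) = c) : C.bracket u v = -C.bracket v u := by
  rw [eq_neg_iff_add_eq_zero]
  ext x
  refine C.eq_zero_of_pairing fun w => ?_
  rw [C.bracket_add_swap]
  have : C.pair u v = fun _ => c := funext h
  rw [this, C.act_const]

/-- For orthogonal sections skew-symmetry carries the Leibniz rule over to the first argument
without the term `⟨u, v⟩ d_E f`. -/
theorem funSmul_bracket [ContMDiffVectorBundle ∞ FE E I] {u v : Cₛ^∞⟮I; FE, E⟯}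
    (f : C^∞⟮I, M; ℝ⟯) (h : ∀ x, C.pairing x (u x) (v x) = 0) :
    C.bracket (funSmul f u) v = funSmul f (C.bracket u v) - funSmul (C.actMap v f) u := by
  have h1 : C.bracket (funSmul f u) v = -C.bracket v (funSmul f u) :=
    C.bracket_swap (c := 0) fun x => by simp [h x]
  rw [h1, bracket_funSmul, C.bracket_swap (c := 0) h]
  ext x
  simp [sub_eq_add_neg, add_comm]

variable {C} {V : ∀ x, Submodule ℝ (E x)}

theorem isGeneralizedPseudometric_top [ContMDiffVectorBundle ∞ FE E I] :
    IsGeneralizedPseudometric C (fun x => (⊤ : Submodule ℝ (E x))) :=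
  ⟨isSmoothSubbundle_top, fun x u _ h => C.pairing_nondegenerate x u fun v => h v trivial⟩

variable (hV : IsGeneralizedPseudometric C V)
include hV

theorem plusPart_spec (a : Cₛ^∞⟮I; FE, E⟯) (x : M) :
    C.plusPart V a x ∈ V x ∧ a x - C.plusPart V a x ∈ C.minus V x := by
  have hex : ∃ s : Cₛ^∞⟮I; FE, E⟯, ∀ x, s x ∈ V x ∧ a x - s x ∈ C.minus V x := by
    obtain ⟨p, hp⟩ := C.exists_riesz hV (fun x => C.pairing x (a x))
      fun w => C.pairing_smooth a w
    refine ⟨p, fun x => ⟨(hp x).1, fun v hv => ?_⟩⟩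
    change C.pairing x v (a x - p x) = 0
    rw [C.pairing_symm, map_sub, LinearMap.sub_apply, (hp x).2 v hv, sub_self]
  exact Classical.epsilon_spec hex x

theorem minusPart_mem (a : Cₛ^∞⟮I; FE, E⟯) (x : M) : C.minusPart V a x ∈ C.minus V x :=
  (plusPart_spec hV a x).2

theorem eq_zero_of_mem_of_mem_minus {x : M} {u : E x} (h1 : u ∈ V x) (h2 : u ∈ C.minus V x) :
    u = 0 :=
  hV.nondegenerate x u h1 fun v hv => by rw [C.pairing_symm]; exact h2 v hv

theorem plusPart_eq {a : Cₛ^∞⟮I; FE, E⟯} {x : M} {u : E x} (h1 : u ∈ V x)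
    (h2 : a x - u ∈ C.minus V x) : C.plusPart V a x = u := by
  obtain ⟨h3, h4⟩ := plusPart_spec hV a x
  refine sub_eq_zero.1 (eq_zero_of_mem_of_mem_minus hV (sub_mem h3 h1) ?_)
  have := sub_mem h2 h4
  rwa [sub_sub_sub_cancel_left] at this

theorem plusPart_add (a b : Cₛ^∞⟮I; FE, E⟯) :
    C.plusPart V (a + b) = C.plusPart V a + C.plusPart V b := by
  ext x
  obtain ⟨h1, h2⟩ := plusPart_spec hV a x
  obtain ⟨h3, h4⟩ := plusPart_spec hV b x
  refine plusPart_eq hV (add_mem h1 h3) ?_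
  have := add_mem h2 h4
  rwa [sub_add_sub_comm] at this

theorem plusPart_funSmul (f : C^∞⟮I, M; ℝ⟯) (a : Cₛ^∞⟮I; FE, E⟯) :
    C.plusPart V (funSmul f a) = funSmul f (C.plusPart V a) := by
  ext x
  obtain ⟨h1, h2⟩ := plusPart_spec hV a x
  refine plusPart_eq hV (Submodule.smul_mem _ _ h1) ?_
  rw [funSmul_apply, funSmul_apply, ← smul_sub]
  exact Submodule.smul_mem _ _ h2

theorem plusPart_smul (c : ℝ) (a : Cₛ^∞⟮I; FE, E⟯) :
    C.plusPart V (c • a) = c • C.plusPart V a := by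
  ext x
  obtain ⟨h1, h2⟩ := plusPart_spec hV a x
  refine plusPart_eq hV (Submodule.smul_mem _ _ h1) ?_
  change c • a x - c • _ ∈ _
  rw [← smul_sub]
  exact Submodule.smul_mem _ _ h2

theorem plusPart_of_mem {a : Cₛ^∞⟮I; FE, E⟯} (ha : ∀ x, a x ∈ V x) : C.plusPart V a = a := by
  ext x
  exact plusPart_eq hV (ha x) (by rw [sub_self]; exact zero_mem _)

theorem plusPart_of_mem_minus {a : Cₛ^∞⟮I; FE, E⟯} (ha : ∀ x, a x ∈ C.minus V x) :
    C.plusPart V a = 0 := by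
  ext x
  exact plusPart_eq hV (zero_mem _) ((sub_zero (a x)).symm ▸ ha x)

/-- The projection to `V₊` as a linear map on sections. -/
noncomputable def plusPartₗ : Cₛ^∞⟮I; FE, E⟯ →ₗ[ℝ] Cₛ^∞⟮I; FE, E⟯ where
  toFun := C.plusPart V
  map_add' := plusPart_add hV
  map_smul' := plusPart_smul hV

/-- Both derivative terms are projected away: `[f v, b]` differs from `f [v, b]` by a multiple of
`v`, which lies in `V₊` and dies in `V₋`; for `w = [v, b]₋`, `[f w, a]` differs from `f [w, a]` by a
multiple of `w`, which dies in `V₊`. So a fibre endomorphism as in the definition of `ricciEnd`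
exists. -/
theorem ricciEnd_spec [ContMDiffVectorBundle ∞ FE E I] {a b : Cₛ^∞⟮I; FE, E⟯}
    (ha : ∀ x, a x ∈ V x) (hb : ∀ x, b x ∈ C.minus V x) (x : M)
    (v : Cₛ^∞⟮I; FE, E⟯) (hv : ∀ y, v y ∈ V y) :
    (C.ricciEnd V a b x ⟨v x, hv x⟩ : E x)
      = C.plusPart V (C.bracket (C.minusPart V (C.bracket v b)) a) x := by
  let R : Cₛ^∞⟮I; FE, E⟯ →ₗ[ℝ] Cₛ^∞⟮I; FE, E⟯ :=
    plusPartₗ hV ∘ₗ C.bracketₗ.flip a ∘ₗ (LinearMap.id - plusPartₗ hV) ∘ₗ C.bracketₗ.flip b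
  have hRdef : ∀ v, R v = C.plusPart V (C.bracket (C.minusPart V (C.bracket v b)) a) :=
    fun _ => rfl
  have hR : ∀ (f : C^∞⟮I, M; ℝ⟯) (v : Cₛ^∞⟮I; FE, E⟯), (∀ x, v x ∈ V x) →
      R (funSmul f v) = funSmul f (R v) := by
    intro f v hv
    have h1 : C.bracket (funSmul f v) b = funSmul f (C.bracket v b) - funSmul (C.actMap b f) v :=
      C.funSmul_bracket f fun x => hb x _ (hv x)
    have h2 : C.minusPart V (C.bracket (funSmul f v) b)
        = funSmul f (C.minusPart V (C.bracket v b)) := by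
      have h3 : C.plusPart V (C.bracket (funSmul f v) b)
          = funSmul f (C.plusPart V (C.bracket v b)) - funSmul (C.actMap b f) v := by
        rw [h1]
        have := map_sub (plusPartₗ hV) (funSmul f (C.bracket v b)) (funSmul (C.actMap b f) v)
        exact this.trans (congrArg₂ _ (plusPart_funSmul hV _ _) (plusPart_of_mem hV fun x =>
          Submodule.smul_mem _ _ (hv x)))
      rw [CourantData.minusPart, h3, h1]
      ext x
      simp [CourantData.minusPart, smul_sub]
    rw [hRdef, hRdef, h2]
    set w := C.minusPart V (C.bracket v b) with hw
    have hwm : ∀ x, w x ∈ C.minus V x := fun x => minusPart_mem hV _ x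
    have h4 : C.bracket (funSmul f w) a = funSmul f (C.bracket w a) - funSmul (C.actMap a f) w :=
      C.funSmul_bracket f fun x => by rw [C.pairing_symm]; exact hwm x _ (ha x)
    rw [h4]
    have := map_sub (plusPartₗ hV) (funSmul f (C.bracket w a)) (funSmul (C.actMap a f) w)
    refine this.trans ?_
    have h5 : plusPartₗ hV (funSmul (C.actMap a f) w) = 0 :=
      plusPart_of_mem_minus hV fun x => Submodule.smul_mem _ _ (hwm x)
    rw [h5, sub_zero]
    exact plusPart_funSmul hV _ _
  exact Classical.epsilon_spec
    (hV.subbundle.exists_end R hR (fun v x => (plusPart_spec hV _ x).1) x) v hv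

end CourantAlgebroid

end CourantCalculus

/-! ### From infinitesimal invariance to invariance under the group -/

section Pull

variable {EM : Type*} [NormedAddCommGroup EM] [NormedSpace ℝ EM] [FiniteDimensional ℝ EM]
  {HM : Type*} [TopologicalSpace HM] {I : ModelWithCorners ℝ EM HM}
  {M : Type*} [TopologicalSpace M] [ChartedSpace HM M] [IsManifold I ∞ M] [T2Space M]
  {FE : Type*} [NormedAddCommGroup FE] [NormedSpace ℝ FE] [FiniteDimensional ℝ FE]
  {E : M → Type*} [TopologicalSpace (TotalSpace FE E)] [∀ x, TopologicalSpace (E x)]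
  [∀ x, AddCommGroup (E x)] [∀ x, Module ℝ (E x)] [FiberBundle FE E] [VectorBundle ℝ FE E]
  [ContMDiffVectorBundle ∞ FE E I]
  {C : CourantAlgebroid I FE E}
  {ES : Type*} [NormedAddCommGroup ES] [NormedSpace ℝ ES] [FiniteDimensional ℝ ES]
  {HS : Type*} [TopologicalSpace HS] {IS : ModelWithCorners ℝ ES HS} [IS.Boundaryless]
  {S : Type*} [TopologicalSpace S] [ChartedSpace HS S] [Group S] [LieGroup IS ∞ S]
  [ConnectedSpace S] [MulAction S M] [ContMDiffSMul IS I ∞ S M]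

variable (FE) in
/-- Linear coordinates on the fibre over `x`. -/
noncomputable def fibreCoord (x : M) : E x ≃ₗ[ℝ] FE :=
  (trivializationAt FE E x).linearEquivAt ℝ x (mem_baseSet_trivializationAt FE E x)

theorem exists_bilin_coord {x : M} (B : LinearMap.BilinForm ℝ (E x)) :
    ∃ B' : FE →L[ℝ] FE →L[ℝ] ℝ, ∀ u v, B' (fibreCoord FE x u) (fibreCoord FE x v) = B u v :=
  ⟨(LinearMap.toContinuousLinearMap.toLinearMap ∘ₗ (B.compl₁₂ (fibreCoord FE x).symm.toLinearMap
    (fibreCoord FE x).symm.toLinearMap)).toContinuousLinearMap, fun u v => by simp⟩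

/-- Estimates the part of the linear system for the pairing in which only one of the two frame
indices is summed; `σ` inserts that index. -/
theorem abs_sum_mul_le {ι κ : Type*} [Fintype ι] [Fintype κ] {σ : ι → κ}
    (hσ : Function.Injective σ) {c : ι → ℝ} {B : ℝ} (hB : 0 ≤ B) (hc : ∀ k, |c k| ≤ B)
    (y : κ → ℝ) : |∑ k, c k * y (σ k)| ≤ B * ∑ p, ‖y p‖ := by
  calc |∑ k, c k * y (σ k)| ≤ ∑ k, |c k * y (σ k)| := Finset.abs_sum_le_sum_abs _ _
    _ ≤ ∑ k, B * ‖y (σ k)‖ := by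
        refine Finset.sum_le_sum fun k _ => ?_
        rw [abs_mul]
        exact mul_le_mul_of_nonneg_right (hc k) (abs_nonneg _)
    _ = B * ∑ p ∈ Finset.univ.map ⟨σ, hσ⟩, ‖y p‖ := by
        rw [Finset.sum_map, Finset.mul_sum]
        rfl
    _ ≤ B * ∑ p, ‖y p‖ := mul_le_mul_of_nonneg_left
        (Finset.sum_le_sum_of_subset_of_nonneg (Finset.subset_univ _)
          fun _ _ _ => norm_nonneg _) hB

/-- `u ↦ ρ(u) f` on the fibre over `x`. -/
noncomputable def CourantAlgebroid.actAt (C : CourantAlgebroid I FE E) (f : M → ℝ) (x : M) :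
    E x →ₗ[ℝ] ℝ :=
  (show TangentSpace I x →ₗ[ℝ] ℝ from (mfderiv I 𝓘(ℝ, ℝ) f x).toLinearMap) ∘ₗ C.anchor x

theorem CourantAlgebroid.act_eq_actAt (C : CourantAlgebroid I FE E) (a : Cₛ^∞⟮I; FE, E⟯)
    (f : M → ℝ) (x : M) : C.act a f x = C.actAt f x (a x) := rfl

namespace EquivariantStructure

variable (K : EquivariantStructure IS S C)

theorem pull_one_of_eq {g : S} (hg : g = 1) (a : ∀ x, E x) (x : M) :
    K.pull g x (a (g • x)) = a x := by
  subst hg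
  exact K.pull_one a x

theorem pull_surjective (g : S) (x : M) : Function.Surjective (K.pull g x) := by
  classical
  intro v
  -- The fibres over `(g⁻¹ * g) • x` and `x` are different types, so the action laws are stated for
  -- arbitrary sections; the section concentrated at one point recovers the law for a single vector.
  have h := K.pull_mul g⁻¹ g (Pi.single x v) x
  rw [K.pull_one_of_eq (inv_mul_cancel g), Pi.single_eq_same] at h
  exact ⟨_, h.symm⟩

theorem pull_injective (g : S) (x : M) : Function.Injective (K.pull g x) := by
  classical
  rw [injective_iff_map_eq_zero]
  intro u hu
  have h := K.pull_mul g g⁻¹ (Pi.single (g • x) u) (g • x)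
  have h2 : ∀ y, y = x → K.pull g y ((Pi.single (g • x) u : ∀ z, E z) (g • y)) = 0 := by
    rintro _ rfl
    rw [Pi.single_eq_same]
    exact hu
  rw [K.pull_one_of_eq (mul_inv_cancel g), Pi.single_eq_same, h2 _ (inv_smul_smul g x),
    map_zero] at h
  exact h

section Derivative

variable {Y : Type*} [NormedAddCommGroup Y] [NormedSpace ℝ Y]

theorem contMDiff_pull (x : M) (Φ : E x →ₗ[ℝ] Y) (a : Cₛ^∞⟮I; FE, E⟯) :
    ContMDiff IS 𝓘(ℝ, Y) ∞ fun g : S => Φ (K.pull g x (a (g • x))) := by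
  intro g₀
  have h1 : ContMDiff IS (I.prod 𝓘(ℝ, FE)) ∞
      (fun g : S => (⟨x, K.pull g x (a (g • x))⟩ : TotalSpace FE E)) :=
    (K.pull_smooth a).comp (contMDiff_id.prodMk contMDiff_const)
  have h2 := (contMDiffAt_totalSpace.1 (h1 g₀)).2
  have h3 := ((Φ ∘ₗ (fibreCoord FE x).symm.toLinearMap).toContinuousLinearMap.contMDiff).contMDiffAt
    (x := fibreCoord FE x (K.pull g₀ x (a (g₀ • x)))) |>.comp g₀ h2
  refine h3.congr_of_eventuallyEq (Filter.Eventually.of_forall fun g => ?_)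
  exact (congrArg Φ ((fibreCoord FE x).symm_apply_apply _)).symm

theorem derivAtOne_pull [FiniteDimensional ℝ Y] (x : M) (Φ : E x →ₗ[ℝ] Y)
    (a : Cₛ^∞⟮I; FE, E⟯) (s : GroupLieAlgebra IS S) :
    derivAtOne IS (fun g : S => Φ (K.pull g x (a (g • x)))) s = -Φ (C.bracket (K.χ s) a x) := by
  rw [← sub_eq_zero, ← Module.forall_dual_apply_eq_zero_iff ℝ]
  intro ψ
  rw [map_sub, map_neg, sub_eq_zero]
  have h1 := derivAtOne_clm_comp ψ.toContinuousLinearMap (K.contMDiff_pull x Φ a) s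
  exact h1.symm.trans (K.integrates s a x (ψ ∘ₗ Φ))

/-- Since `pull (h * g)` is `pull g` after `pull h`, differentiating in `h` at `1` only involves the
infinitesimal action at `g • x`. This is why right translations are used throughout. -/
theorem derivAtOne_pull_mul [FiniteDimensional ℝ Y] (g : S) (x : M) (Φ : E x →ₗ[ℝ] Y)
    (a : Cₛ^∞⟮I; FE, E⟯) (s : GroupLieAlgebra IS S) :
    derivAtOne IS (fun h : S => Φ (K.pull (h * g) x (a ((h * g) • x)))) s
      = -Φ (K.pull g x (C.bracket (K.χ s) a (g • x))) := by
  have : (fun h : S => Φ (K.pull (h * g) x (a ((h * g) • x))))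
      = fun h => (Φ ∘ₗ K.pull g x) (K.pull h (g • x) (a (h • g • x))) := by
    funext h
    rw [K.pull_mul]
    rfl
  rw [this, K.derivAtOne_pull]
  rfl

theorem contMDiff_pull_bilin (x : M) (B : LinearMap.BilinForm ℝ (E x)) (a b : Cₛ^∞⟮I; FE, E⟯) :
    ContMDiff IS 𝓘(ℝ, ℝ) ∞
      fun g : S => B (K.pull g x (a (g • x))) (K.pull g x (b (g • x))) := by
  obtain ⟨B', hB'⟩ := exists_bilin_coord (FE := FE) B
  have h := (B'.contMDiff.comp (K.contMDiff_pull x (fibreCoord FE x).toLinearMap a)).clm_apply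
    (K.contMDiff_pull x (fibreCoord FE x).toLinearMap b)
  exact h.congr fun g => (hB' _ _).symm

theorem derivAtOne_pull_bilin (x : M) (B : LinearMap.BilinForm ℝ (E x)) (a b : Cₛ^∞⟮I; FE, E⟯)
    (s : GroupLieAlgebra IS S) :
    derivAtOne IS (fun g : S => B (K.pull g x (a (g • x))) (K.pull g x (b (g • x)))) s
      = -B (C.bracket (K.χ s) a x) (b x) - B (a x) (C.bracket (K.χ s) b x) := by
  obtain ⟨B', hB'⟩ := exists_bilin_coord (FE := FE) B
  have h := derivAtOne_bilin B' (K.contMDiff_pull x (fibreCoord FE x).toLinearMap a)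
    (K.contMDiff_pull x (fibreCoord FE x).toLinearMap b) s
  rw [K.derivAtOne_pull, K.derivAtOne_pull] at h
  simp only [LinearEquiv.coe_coe, map_neg, neg_apply, hB',
    K.pull_one a x, K.pull_one b x] at h
  rw [h]
  ring

end Derivative

/-- Smooth invariant functions are constant on orbits. -/
theorem smul_eq_of_act_eq_zero {f : C^∞⟮I, M; ℝ⟯} (hf : ∀ s x, C.act (K.χ s) f x = 0)
    (g : S) (x : M) : f (g • x) = f x := by
  have hsm : ContMDiff IS 𝓘(ℝ, ℝ) ∞ fun g : S => f (g • x) :=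
    f.contMDiff.comp (contMDiff_id.smul contMDiff_const)
  refine (eq_of_mfderiv_mul_eq_zero hsm (fun s g => ?_) g).trans (by rw [one_smul])
  have := K.integrates_base s f (g • x)
  rw [hf, neg_zero] at this
  simp only [mul_smul]
  exact this

/-- Invariant sections are preserved by the action. -/
theorem pull_eq_of_isInvariant {a : Cₛ^∞⟮I; FE, E⟯} (ha : K.IsInvariant a) (g : S) (x : M) :
    K.pull g x (a (g • x)) = a x := by
  apply (fibreCoord FE x).injective
  have h := eq_of_mfderiv_mul_eq_zero (K.contMDiff_pull x (fibreCoord FE x).toLinearMap a)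
    (fun s g => by rw [K.derivAtOne_pull_mul, ha s]; simp) g
  rw [K.pull_one a x] at h
  exact h

/-- A section preserved by the action is invariant. -/
theorem isInvariant_of_pull_eq {a : Cₛ^∞⟮I; FE, E⟯}
    (ha : ∀ (g : S) x, K.pull g x (a (g • x)) = a x) : K.IsInvariant a := by
  intro s
  ext x
  apply (fibreCoord FE x).injective
  have h := K.derivAtOne_pull x (fibreCoord FE x).toLinearMap a s
  simp only [ha, derivAtOne_const] at h
  have h' := neg_eq_zero.1 h.symm
  rw [ContMDiffSection.coe_zero, Pi.zero_apply, map_zero]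
  exact h'

theorem tendsto_smul_one (_K : EquivariantStructure IS S C) (x : M) : Filter.Tendsto (fun g : S => g • x) (𝓝 1) (𝓝 x) := by
  have : ContMDiff IS I ∞ fun g : S => g • x := contMDiff_id.smul contMDiff_const
  simpa [ContinuousAt] using this.continuous.continuousAt (x := 1)

section Subbundle

variable {W : ∀ x, Submodule ℝ (E x)} (hW : IsSmoothSubbundle I FE W)
  (hinv : ∀ s (a : Cₛ^∞⟮I; FE, E⟯), (∀ x, a x ∈ W x) → ∀ x, C.bracket (K.χ s) a x ∈ W x)
include hW hinv

/-- Supplies the bounded coefficient matrix of the linear system: the infinitesimal action expressed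
in a local frame along the orbit. -/
theorem exists_bracket_coeff {x : M} {r : ℕ} {e : Fin r → Cₛ^∞⟮I; FE, E⟯} (he : IsFrameAt W e x)
    (s : GroupLieAlgebra IS S) (i : Fin r) :
    ∃ (c : Fin r → M → ℝ) (B : ℝ), (∀ᶠ g in 𝓝 (1 : S),
      C.bracket (K.χ s) (e i) (g • x) = ∑ j, c j (g • x) • e j (g • x) ∧
      ∀ j, |c j (g • x)| ≤ B) := by
  obtain ⟨c, hc⟩ := he.exists_contMDiff_coeff (a := C.bracket (K.χ s) (e i))
    (Filter.Eventually.of_forall (hinv s _ (he.mem i)))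
  refine ⟨fun j => c j, ∑ j, (|c j x| + 1), ?_⟩
  have h1 := (K.tendsto_smul_one x).eventually hc
  have h2 : ∀ j, ∀ᶠ g in 𝓝 (1 : S), |c j (g • x)| ≤ |c j x| + 1 := fun j =>
    (((c j).contMDiff.continuous.continuousAt.tendsto.comp
      (K.tendsto_smul_one x)).abs.eventually_le_const
        (lt_add_one |c j x|))
  filter_upwards [h1, Filter.eventually_all.2 h2] with g hg1 hg2
  exact ⟨hg1, fun j => (hg2 j).trans (Finset.single_le_sum (f := fun j => |c j x| + 1)
    (fun _ _ => by positivity) (Finset.mem_univ j))⟩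

/-- The classes modulo `W x` of the transported frame vectors solve a homogeneous linear system and
vanish at `1`. -/
theorem eventually_pull_mem (x : M) : ∀ᶠ g in 𝓝 (1 : S), ∀ u ∈ W (g • x), K.pull g x u ∈ W x := by
  have : FiniteDimensional ℝ (E x) := (fibreCoord FE x).symm.finiteDimensional
  obtain ⟨r, e, he⟩ := hW.exists_frame x
  let Φ : E x →ₗ[ℝ] (Fin _ → ℝ) :=
    (Module.finBasis ℝ (E x ⧸ W x)).equivFun.toLinearMap ∘ₗ (W x).mkQ
  have hΦ : ∀ u, Φ u = 0 ↔ u ∈ W x := fun u => by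
    simp only [Φ, LinearMap.comp_apply, LinearEquiv.coe_coe, LinearEquiv.map_eq_zero_iff,
      Submodule.mkQ_apply, Submodule.Quotient.mk_eq_zero]
  have key := eventually_eq_zero_of_mfderiv_mul_le_sum (IS := IS)
    (y := fun i (g : S) => Φ (K.pull g x (e i (g • x)))) (fun i => K.contMDiff_pull x Φ (e i)) ?_ ?_
  · filter_upwards [key, (K.tendsto_smul_one x).eventually he.nearby]
      with g hg hf u hu
    obtain ⟨c, rfl⟩ := hf.exists_coeff hu
    rw [map_sum]
    refine Submodule.sum_mem _ fun i _ => ?_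
    rw [map_smul]
    exact Submodule.smul_mem _ _ ((hΦ _).1 (hg i))
  · intro s i
    obtain ⟨c, B, hc⟩ := K.exists_bracket_coeff hW hinv he s i
    refine ⟨B, hc.mono fun g hg => ?_⟩
    rw [K.derivAtOne_pull_mul, norm_neg, hg.1, map_sum, map_sum, Finset.mul_sum]
    refine (norm_sum_le _ _).trans (Finset.sum_le_sum fun j _ => ?_)
    rw [map_smul, map_smul, norm_smul]
    exact mul_le_mul_of_nonneg_right (hg.2 j) (norm_nonneg _)
  · intro i
    rw [hΦ, K.pull_one (e i) x]
    exact he.mem i x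

/-- A subbundle that is infinitesimally invariant is invariant under the action. -/
theorem pull_mem (g : S) (x : M) {u : E (g • x)} (hu : u ∈ W (g • x)) : K.pull g x u ∈ W x := by
  have : IsTopologicalGroup S := topologicalGroup_of_lieGroup IS ∞
  have hfd := hW.finiteDimensional
  suffices h : ∀ a : Cₛ^∞⟮I; FE, E⟯, (∀ y, a y ∈ W y) → K.pull g x (a (g • x)) ∈ W x by
    obtain ⟨a, ha, rfl⟩ := hW.exists_section hu
    exact h a ha
  refine mem_of_eventually_mul_mem_iff
    (G := {g : S | ∀ a : Cₛ^∞⟮I; FE, E⟯, (∀ y, a y ∈ W y) → K.pull g x (a (g • x)) ∈ W x})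
    (fun a ha => by rw [K.pull_one a x]; exact ha x) (fun g => ?_) g
  obtain ⟨r, e, he⟩ := hW.exists_frame (g • x)
  filter_upwards [K.eventually_pull_mem hW hinv (g • x),
    (K.tendsto_smul_one (g • x)).eventually he.nearby] with h hh hfr
  constructor
  · intro H a ha
    -- The clopen argument needs both directions. `pull h` is injective and the two fibres of `W`
    -- have equal dimension, so an inclusion is an equality.
    have hmap : (W (h • g • x)).map (K.pull h (g • x)) = W (g • x) := by
      apply Submodule.eq_of_le_of_finrank_eq
      · rintro _ ⟨u, hu, rfl⟩
        exact hh u hu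
      · rw [← ((W (h • g • x)).equivMapOfInjective _ (K.pull_injective h (g • x))).finrank_eq,
          hfr.finrank_eq, he.finrank_eq]
    obtain ⟨u, hu, hu'⟩ : a (g • x) ∈ (W (h • g • x)).map (K.pull h (g • x)) := hmap ▸ ha _
    obtain ⟨a', ha', rfl⟩ := hW.exists_section hu
    have := H a' ha'
    rwa [K.pull_mul, hu'] at this
  · intro H a ha
    rw [K.pull_mul]
    obtain ⟨a', ha', h'⟩ := hW.exists_section (hh _ (ha _))
    have := H a' ha'
    rwa [h'] at this

end Subbundle

/-- The defect `D` between the transported pairing and the pairing at `g • x` vanishes at `1`. By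
the invariance axiom of the pairing, its matrix in a local frame solves a homogeneous linear system.
-/
theorem eventually_pairing_pull (x : M) : ∀ᶠ g in 𝓝 (1 : S), ∀ u v : E (g • x),
    C.pairing x (K.pull g x u) (K.pull g x v) = C.pairing (g • x) u v := by
  have hW := isSmoothSubbundle_top (I := I) (FE := FE) (E := E)
  obtain ⟨r, e, he⟩ := hW.exists_frame x
  have hpsm : ∀ i : Fin r × Fin r, ContMDiff IS 𝓘(ℝ, ℝ) ∞ fun g : S =>
      C.pair (e i.1) (e i.2) (g • x) := fun i =>
    (C.pairing_smooth (e i.1) (e i.2)).comp (contMDiff_id.smul contMDiff_const)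
  let D : ∀ g : S, LinearMap.BilinForm ℝ (E (g • x)) := fun g =>
    (C.pairing x).compl₁₂ (K.pull g x) (K.pull g x) - C.pairing (g • x)
  have hD : ∀ g u v, D g u v = C.pairing x (K.pull g x u) (K.pull g x v)
      - C.pairing (g • x) u v := fun g u v => rfl
  have key := eventually_eq_zero_of_mfderiv_mul_le_sum (IS := IS)
    (y := fun (i : Fin r × Fin r) (g : S) => D g (e i.1 (g • x)) (e i.2 (g • x)))
    (fun i => (K.contMDiff_pull_bilin x _ (e i.1) (e i.2)).sub (hpsm i)) ?_ ?_
  · filter_upwards [key, (K.tendsto_smul_one x).eventually he.nearby]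
      with g hg hf u v
    rw [← sub_eq_zero, ← hD]
    obtain ⟨c, rfl⟩ := hf.exists_coeff (u := u) trivial
    obtain ⟨d, rfl⟩ := hf.exists_coeff (u := v) trivial
    simp only [map_sum, map_smul, LinearMap.sum_apply, LinearMap.smul_apply, hg (_, _), smul_zero,
      Finset.sum_const_zero]
  · intro s ⟨i, j⟩
    obtain ⟨c, B, hc⟩ := K.exists_bracket_coeff hW (fun _ _ _ _ => trivial) he s i
    obtain ⟨c', B', hc'⟩ := K.exists_bracket_coeff hW (fun _ _ _ _ => trivial) he s j
    refine ⟨B + B', ?_⟩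
    filter_upwards [hc, hc'] with g hg hg'
    have e1 : derivAtOne IS (fun h : S => D (h * g) (e i ((h * g) • x)) (e j ((h * g) • x))) s
        = -D g (C.bracket (K.χ s) (e i) (g • x)) (e j (g • x))
          - D g (e i (g • x)) (C.bracket (K.χ s) (e j) (g • x)) := by
      have h1 : (fun h : S => D (h * g) (e i ((h * g) • x)) (e j ((h * g) • x)))
          = fun h : S => ((C.pairing x).compl₁₂ (K.pull g x) (K.pull g x))
              (K.pull h (g • x) (e i (h • g • x))) (K.pull h (g • x) (e j (h • g • x)))
            - C.pair (e i) (e j) (h • g • x) := by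
        funext h
        rw [hD, K.pull_mul h g (e i), K.pull_mul h g (e j), CourantData.pair, mul_smul]
        rfl
      have hp : ContMDiff IS 𝓘(ℝ, ℝ) ∞ fun h : S => C.pair (e i) (e j) (h • g • x) :=
        (C.pairing_smooth (e i) (e j)).comp (contMDiff_id.smul contMDiff_const)
      have h2 : derivAtOne IS (fun h : S => C.pair (e i) (e j) (h • g • x)) s
          = -C.act (K.χ s) (C.pair (e i) (e j)) (g • x) :=
        K.integrates_base s (C.pairMap (e i) (e j)) (g • x)
      rw [h1, derivAtOne_sub (K.contMDiff_pull_bilin _ _ _ _) hp, K.derivAtOne_pull_bilin, h2,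
        C.pairing_invariant, hD, hD]
      simp only [LinearMap.compl₁₂_apply]
      ring
    rw [e1, hg.1, hg'.1]
    simp only [map_sum, map_smul, LinearMap.sum_apply, LinearMap.smul_apply, smul_eq_mul]
    have hB := (abs_nonneg _).trans (hg.2 i)
    have hB' := (abs_nonneg _).trans (hg'.2 j)
    have b1 := abs_sum_mul_le (σ := fun k => (k, j)) (fun _ _ h => congrArg Prod.fst h) hB hg.2
      (fun p : Fin r × Fin r => D g (e p.1 (g • x)) (e p.2 (g • x)))
    have b2 := abs_sum_mul_le (σ := fun k => (i, k)) (fun _ _ h => congrArg Prod.snd h) hB' hg'.2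
      (fun p : Fin r × Fin r => D g (e p.1 (g • x)) (e p.2 (g • x)))
    rw [add_mul, ← neg_add', norm_neg]
    exact (norm_add_le _ _).trans (add_le_add b1 b2)
  · rintro ⟨i, j⟩
    change C.pairing x _ _ - C.pair (e i) (e j) ((1 : S) • x) = 0
    rw [K.pull_one (e i) x, K.pull_one (e j) x, one_smul]
    exact sub_self _

/-- The action preserves the pairing. -/
theorem pairing_pull (g : S) (x : M) (u v : E (g • x)) :
    C.pairing x (K.pull g x u) (K.pull g x v) = C.pairing (g • x) u v := by
  have : IsTopologicalGroup S := topologicalGroup_of_lieGroup IS ∞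
  suffices h : ∀ a b : Cₛ^∞⟮I; FE, E⟯, C.pairing x (K.pull g x (a (g • x)))
      (K.pull g x (b (g • x))) = C.pairing (g • x) (a (g • x)) (b (g • x)) by
    obtain ⟨a, rfl⟩ := exists_section_eq (I := I) (FE := FE) u
    obtain ⟨b, rfl⟩ := exists_section_eq (I := I) (FE := FE) v
    exact h a b
  refine mem_of_eventually_mul_mem_iff
    (G := {g : S | ∀ a b : Cₛ^∞⟮I; FE, E⟯, C.pairing x (K.pull g x (a (g • x)))
      (K.pull g x (b (g • x))) = C.pair a b (g • x)})
    (fun a b => by rw [K.pull_one a x, K.pull_one b x, one_smul]; rfl) (fun g => ?_) g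
  filter_upwards [K.eventually_pairing_pull (g • x)] with h hh
  constructor
  · intro H a b
    obtain ⟨u, hu⟩ := K.pull_surjective h (g • x) (a (g • x))
    obtain ⟨v, hv⟩ := K.pull_surjective h (g • x) (b (g • x))
    obtain ⟨a', rfl⟩ := exists_section_eq (I := I) (FE := FE) u
    obtain ⟨b', rfl⟩ := exists_section_eq (I := I) (FE := FE) v
    have := H a' b'
    rw [K.pull_mul h g a', K.pull_mul h g b', hu, hv, mul_smul] at this
    rw [this, CourantData.pair, CourantData.pair, ← hh, hu, hv]
  · intro H a b
    obtain ⟨a', ha'⟩ := exists_section_eq (I := I) (FE := FE) (K.pull h (g • x) (a (h • g • x)))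
    obtain ⟨b', hb'⟩ := exists_section_eq (I := I) (FE := FE) (K.pull h (g • x) (b (h • g • x)))
    have := H a' b'
    rw [K.pull_mul h g a, K.pull_mul h g b, ← ha', ← hb', this, mul_smul, CourantData.pair,
      CourantData.pair, ha', hb', hh]

/-- The action preserves the derivative of an invariant function along the anchor. -/
theorem act_pull {f : C^∞⟮I, M; ℝ⟯} (hf : ∀ s x, C.act (K.χ s) f x = 0) (g : S) (x : M)
    (u : E (g • x)) :
    C.actAt f x (K.pull g x u) = C.actAt f (g • x) u := by
  -- Here `p = d_E f`. For an invariant function it is an invariant section, so the action fixes it,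
  -- and `u · f = ⟨p, u⟩` reduces the claim to invariance of the pairing.
  obtain ⟨p, hp⟩ := C.exists_riesz CourantAlgebroid.isGeneralizedPseudometric_top
    (C.actAt f)
    fun w => C.contMDiff_act w f.contMDiff
  have hp' : ∀ x u, C.pairing x (p x) u = C.actAt f x u :=
    fun x u => (hp x).2 u trivial
  have hpinv : K.IsInvariant p := by
    intro s
    ext x
    refine C.eq_zero_of_pairing fun w => ?_
    have hwp : ∀ w : Cₛ^∞⟮I; FE, E⟯, C.pair w p = C.act w f := by
      intro w
      funext y
      rw [CourantData.pair, C.pairing_symm]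
      exact hp' y (w y)
    have h1 := C.pairing_invariant (K.χ s) w p x
    have h2 : C.pairing x (C.bracket (K.χ s) w x) (p x) = C.act (C.bracket (K.χ s) w) f x :=
      congrFun (hwp (C.bracket (K.χ s) w)) x
    have h3 : C.act (K.χ s) f = fun _ => 0 := funext (hf s)
    rw [hwp, h2, C.act_bracket, h3, C.act_const] at h1
    linarith
  rw [← hp', ← K.pull_eq_of_isInvariant hpinv g x, K.pairing_pull, hp']

end EquivariantStructure

end Pull

/-! ### The isotropic subbundle `𝔰_E`, invariant sections and equivariant divergences -/

section Isotropic

variable {EM : Type*} [NormedAddCommGroup EM] [NormedSpace ℝ EM] [FiniteDimensional ℝ EM]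
  {HM : Type*} [TopologicalSpace HM] {I : ModelWithCorners ℝ EM HM}
  {M : Type*} [TopologicalSpace M] [ChartedSpace HM M] [IsManifold I ∞ M] [T2Space M]
  {FE : Type*} [NormedAddCommGroup FE] [NormedSpace ℝ FE] [FiniteDimensional ℝ FE]
  {E : M → Type*} [TopologicalSpace (TotalSpace FE E)] [∀ x, TopologicalSpace (E x)]
  [∀ x, AddCommGroup (E x)] [∀ x, Module ℝ (E x)] [FiberBundle FE E] [VectorBundle ℝ FE E]
  [ContMDiffVectorBundle ∞ FE E I]
  {C : CourantAlgebroid I FE E}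
  {ES : Type*} [NormedAddCommGroup ES] [NormedSpace ℝ ES] [FiniteDimensional ℝ ES]
  [CompleteSpace ES]
  {HS : Type*} [TopologicalSpace HS] {IS : ModelWithCorners ℝ ES HS} [IS.Boundaryless]
  {S : Type*} [TopologicalSpace S] [ChartedSpace HS S] [Group S] [LieGroup IS ∞ S]
  [ConnectedSpace S] [MulAction S M] [ContMDiffSMul IS I ∞ S M]

variable (IS S) in
/-- A basis of the Lie algebra. -/
noncomputable def lieBasis :
    Module.Basis (Fin (Module.finrank ℝ ES)) ℝ (GroupLieAlgebra IS S) :=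
  (Module.finBasis ℝ ES : Module.Basis (Fin (Module.finrank ℝ ES)) ℝ ES)

namespace EquivariantStructure

variable (K : EquivariantStructure IS S C)

theorem χ_mem (s : GroupLieAlgebra IS S) (x : M) : K.χ s x ∈ K.sE x := ⟨s, rfl⟩

theorem mem_sPerp_iff {x : M} {u : E x} :
    u ∈ K.sPerp x ↔ ∀ s, C.pairing x (K.χ s x) u = 0 :=
  ⟨fun h s => h _ (K.χ_mem s x), by rintro h _ ⟨s, rfl⟩; exact h s⟩

theorem sE_le_sPerp (x : M) : K.sE x ≤ K.sPerp x := by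
  rintro _ ⟨s, rfl⟩
  exact K.mem_sPerp_iff.2 fun t => K.χ_isotropic t s x

/-- Evaluation of `χ` at a point. -/
noncomputable def χAt (x : M) : GroupLieAlgebra IS S →ₗ[ℝ] E x where
  toFun s := K.χ s x
  map_add' s t := by rw [map_add]; rfl
  map_smul' c s := by rw [map_smul]; rfl

theorem isFrameAt_sE (x : M) : IsFrameAt K.sE (fun i => K.χ (lieBasis IS S i)) x := by
  refine ⟨fun i x => K.χ_mem _ x, Filter.Eventually.of_forall fun y => ⟨?_, ?_⟩⟩
  · exact (lieBasis IS S).linearIndependent.map' (K.χAt y)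
      (LinearMap.ker_eq_bot.2 (K.χ_injective y))
  · have h1 : (Set.range fun i => K.χ (lieBasis IS S i) y)
        = K.χAt y '' Set.range (lieBasis IS S) := by
      rw [← Set.range_comp]
      rfl
    rw [h1, ← Submodule.map_span, (lieBasis IS S).span_eq, Submodule.map_top]
    rfl

theorem isSmoothSubbundle_sE : IsSmoothSubbundle I FE K.sE := fun x =>
  ⟨_, _, (K.isFrameAt_sE x).frame⟩

/-- Sections of `𝔰_E` are combinations of the sections `χ(s)`. -/
theorem exists_eq_sum_χ {c : Cₛ^∞⟮I; FE, E⟯} (hc : ∀ x, c x ∈ K.sE x) :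
    ∃ f : Fin (Module.finrank ℝ ES) → C^∞⟮I, M; ℝ⟯,
      c = ∑ i, funSmul (f i) (K.χ (lieBasis IS S i)) := by
  choose f hf using fun x => (K.isFrameAt_sE x).exists_coeff (hc x)
  refine ⟨fun i => ⟨fun x => f x i, fun x => (K.isFrameAt_sE x).contMDiffAt_coeff
    (c := fun i x => f x i) (Filter.Eventually.of_forall hf) i⟩, ?_⟩
  ext x
  rw [contMDiffSection_sum_apply]
  exact hf x

/-- By the Leibniz rule in the second argument, preservation of `𝔰_E` need only be tested on the
generators `χ(s)`. -/
theorem bracket_mem_sE_of_bracket_χ {u c : Cₛ^∞⟮I; FE, E⟯}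
    (hu : ∀ s x, C.bracket u (K.χ s) x ∈ K.sE x) (hc : ∀ x, c x ∈ K.sE x) (x : M) :
    C.bracket u c x ∈ K.sE x := by
  obtain ⟨f, rfl⟩ := K.exists_eq_sum_χ hc
  rw [C.bracket_sum, contMDiffSection_sum_apply]
  refine Submodule.sum_mem _ fun i _ => ?_
  rw [C.bracket_funSmul]
  exact add_mem (Submodule.smul_mem _ _ (hu _ x)) (Submodule.smul_mem _ _ (K.χ_mem _ x))

theorem pull_mem_sE (g : S) (x : M) {u : E (g • x)} (hu : u ∈ K.sE (g • x)) :
    K.pull g x u ∈ K.sE x := by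
  refine K.pull_mem K.isSmoothSubbundle_sE (fun s a ha => ?_) g x hu
  refine K.bracket_mem_sE_of_bracket_χ (fun t x => ?_) ha
  rw [K.χ_bracket]
  exact K.χ_mem _ x

/-- Each `χ(s)` at `x` is the image under `pull g` of a vector of `𝔰_E` at `g • x`, and the action
preserves the pairing. -/
theorem pull_mem_sPerp (g : S) (x : M) {u : E (g • x)} (hu : u ∈ K.sPerp (g • x)) :
    K.pull g x u ∈ K.sPerp x := by
  refine K.mem_sPerp_iff.2 fun s => ?_
  have h := K.pull_mul g⁻¹ g (K.χ s) x
  rw [K.pull_one_of_eq (inv_mul_cancel g) (K.χ s)] at h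
  rw [h, K.pairing_pull]
  exact hu _ (K.pull_mem_sE _ _ (K.χ_mem s _))

section Invariant

variable {K} {a b c : Cₛ^∞⟮I; FE, E⟯}

theorem IsInvariant.sub (ha : K.IsInvariant a) (hb : K.IsInvariant b) : K.IsInvariant (a - b) :=
  fun s => by rw [C.bracket_sub, ha, hb, sub_zero]

theorem IsInvariant.bracket (ha : K.IsInvariant a) (hb : K.IsInvariant b) :
    K.IsInvariant (C.bracket a b) := fun s => by
  rw [C.jacobi, ha, hb, C.zero_bracket, C.bracket_zero, add_zero]

theorem IsInvariant.bracket_χ (ha : K.IsInvariant a) (ha' : ∀ x, a x ∈ K.sPerp x)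
    (s : GroupLieAlgebra IS S) : C.bracket a (K.χ s) = 0 := by
  rw [C.bracket_swap (c := 0), ha, neg_zero]
  intro x
  rw [C.pairing_symm]
  exact ha' x _ (K.χ_mem s x)

/-- Differentiate `⟨χ(s), b⟩ = 0` along `a` and use `[a, χ(s)] = 0`. -/
theorem IsInvariant.bracket_mem_sPerp (ha : K.IsInvariant a) (ha' : ∀ x, a x ∈ K.sPerp x)
    (hb' : ∀ x, b x ∈ K.sPerp x) (x : M) : C.bracket a b x ∈ K.sPerp x := by
  refine K.mem_sPerp_iff.2 fun s => ?_
  have h := C.pairing_invariant a (K.χ s) b x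
  have h0 : C.pair (K.χ s) b = fun _ => 0 := funext fun y => hb' y _ (K.χ_mem s y)
  rw [h0, C.act_const, ha.bracket_χ ha' s] at h
  simpa using h.symm

theorem IsInvariant.bracket_mem_sE (ha : K.IsInvariant a) (ha' : ∀ x, a x ∈ K.sPerp x)
    (hc : ∀ x, c x ∈ K.sE x) (x : M) : C.bracket a c x ∈ K.sE x :=
  K.bracket_mem_sE_of_bracket_χ
    (fun s x => by rw [ha.bracket_χ ha' s]; exact zero_mem _) hc x

theorem IsInvariant.bracket_mem_sE' (ha : K.IsInvariant a) (ha' : ∀ x, a x ∈ K.sPerp x)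
    (hc : ∀ x, c x ∈ K.sE x) (x : M) : C.bracket c a x ∈ K.sE x := by
  rw [C.bracket_swap (c := 0) fun x => ha' x _ (hc x)]
  exact neg_mem (ha.bracket_mem_sE ha' hc x)

/-- An equivariant divergence vanishes on invariant sections of `𝔰_E`. -/
theorem IsEquivariantDiv.eq_zero_of_mem_sE {div : Divergence C} (hdiv : K.IsEquivariantDiv div)
    (hc : K.IsInvariant c) (hc' : ∀ x, c x ∈ K.sE x) (x : M) : div.toLin c x = 0 := by
  obtain ⟨f, rfl⟩ := K.exists_eq_sum_χ hc'
  set β := lieBasis IS S with hβ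
  have h1 : div.toLin (∑ i, funSmul (f i) (K.χ (β i))) x
      = ∑ i, (f i x * -LinearMap.trace ℝ _ (LieAlgebra.ad ℝ (GroupLieAlgebra IS S) (β i))
        + C.act (K.χ (β i)) (f i) x) := by
    have hev : ∀ g : Fin (Module.finrank ℝ ES) → C^∞⟮I, M; ℝ⟯, (∑ i, g i) x = ∑ i, g i x :=
      fun g => map_sum ((Pi.evalAddMonoidHom (fun _ : M => ℝ) x).comp
        ContMDiffMap.coeFnAddMonoidHom) g _
    rw [map_sum, hev]
    exact Finset.sum_congr rfl fun i _ => by rw [div.leibniz, hdiv.unimodular]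
  -- The `k`-th coefficient of `[χ(β k), c] = 0`. Summing over `k` expresses the derivative terms
  -- through the traces of `ad`, and they cancel the divergences of the generators.
  have h2 : ∀ k, C.act (K.χ (β k)) (f k) x + ∑ i, f i x * β.repr ⁅β k, β i⁆ k = 0 := by
    intro k
    have h3 := congrArg (fun s => s x) (hc (β k))
    simp only [C.bracket_sum, C.bracket_funSmul, contMDiffSection_sum_apply, K.χ_bracket] at h3
    have h4 : K.χAt x (∑ i, (f i x • ⁅β k, β i⁆ + C.act (K.χ (β k)) (f i) x • β i)) = 0 := by
      rw [map_sum]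
      refine Eq.trans (Finset.sum_congr rfl fun i _ => ?_) h3
      rw [map_add, map_smul, map_smul]
      rfl
    have h5 := (injective_iff_map_eq_zero (K.χAt x)).1 (K.χ_injective x) _ h4
    have h6 := congrArg (fun s => β.repr s k) h5
    simp only [map_sum, map_add, map_smul, Finsupp.coe_finsetSum, Finset.sum_apply,
      Finsupp.add_apply, Finsupp.smul_apply, smul_eq_mul, Finset.sum_add_distrib,
      Module.Basis.repr_self, map_zero, Finsupp.coe_zero, Pi.zero_apply,
      Finsupp.single_apply, mul_ite, mul_one, mul_zero, Finset.sum_ite_eq', Finset.mem_univ,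
      if_true] at h6
    linarith
  have h7 : ∀ i, LinearMap.trace ℝ _ (LieAlgebra.ad ℝ (GroupLieAlgebra IS S) (β i))
      = -∑ k, β.repr ⁅β k, β i⁆ k := by
    intro i
    rw [LinearMap.trace_eq_matrix_trace ℝ β, Matrix.trace, ← Finset.sum_neg_distrib]
    refine Finset.sum_congr rfl fun k _ => ?_
    rw [Matrix.diag_apply, LinearMap.toMatrix_apply, LieAlgebra.ad_apply, ← lie_skew, map_neg]
    rfl
  rw [h1, Finset.sum_add_distrib]
  have h8 : ∑ k, C.act (K.χ (β k)) (f k) x = -∑ k, ∑ i, f i x * β.repr ⁅β k, β i⁆ k := by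
    rw [← Finset.sum_neg_distrib]
    exact Finset.sum_congr rfl fun k _ => eq_neg_of_add_eq_zero_left (h2 k)
  rw [h8, Finset.sum_comm]
  simp only [h7, neg_neg, Finset.mul_sum]
  exact add_neg_cancel _

/-- The projections of an invariant section are invariant. -/
theorem IsAdmissible.isInvariant_plusPart {V : ∀ x, Submodule ℝ (E x)} (hV : K.IsAdmissible V)
    (ha : K.IsInvariant a) : K.IsInvariant (C.plusPart V a) := by
  intro s
  ext x
  have hp := fun x => CourantAlgebroid.plusPart_spec hV.pseudometric a x
  refine CourantAlgebroid.eq_zero_of_mem_of_mem_minus hV.pseudometric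
    (hV.invariant s _ (fun y => (hp y).1) x) fun v hv => ?_
  obtain ⟨w, hw, rfl⟩ := hV.pseudometric.subbundle.exists_section hv
  -- Differentiating this orthogonality along `χ(s)` shows that `[χ(s), a₊]` is orthogonal to `V`;
  -- it also lies in `V`, hence it is zero.
  have h0 : C.pair w (a - C.plusPart V a) = fun _ => 0 := funext fun y => (hp y).2 _ (hw y)
  have h := C.pairing_invariant (K.χ s) w (a - C.plusPart V a) x
  have h1 : C.pairing x (C.bracket (K.χ s) w x) ((a - C.plusPart V a) x) = 0 :=
    (hp x).2 _ (hV.invariant s w hw x)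
  rw [h0, C.act_const, h1, C.bracket_sub, ha, zero_sub, zero_add] at h
  have h2 : C.pairing x (w x) (-(C.bracket (K.χ s) (C.plusPart V a) x)) = 0 := h.symm
  rw [map_neg, neg_eq_zero] at h2
  exact h2

theorem IsAdmissible.pull_mem {V : ∀ x, Submodule ℝ (E x)} (hV : K.IsAdmissible V)
    (g : S) (x : M) {u : E (g • x)} (hu : u ∈ V (g • x)) : K.pull g x u ∈ V x :=
  K.pull_mem hV.pseudometric.subbundle hV.invariant g x hu

end Invariant

end EquivariantStructure

end Isotropic

/-! ### Local sections of submersions and descent of smoothness -/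

section Submersions

variable {EM : Type*} [NormedAddCommGroup EM] [NormedSpace ℝ EM]
  {HM : Type*} [TopologicalSpace HM] {I : ModelWithCorners ℝ EM HM} [I.Boundaryless]
  {M : Type*} [TopologicalSpace M] [ChartedSpace HM M]
  {EN : Type*} [NormedAddCommGroup EN] [NormedSpace ℝ EN]
  {HN : Type*} [TopologicalSpace HN] {IN : ModelWithCorners ℝ EN HN} [IN.Boundaryless]
  {N : Type*} [TopologicalSpace N] [ChartedSpace HN N]
  {pr : M → N}

/-- A submersion has smooth local sections. -/
theorem Manifold.IsSubmersionAtOfComplement.exists_localSection {G : Type*} [NormedAddCommGroup G]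
    [NormedSpace ℝ G] {x : M} (h : IsSubmersionAtOfComplement G I IN ∞ pr x) :
    ∃ τ : N → M, τ (pr x) = x ∧
      ∀ᶠ y in 𝓝 (pr x), pr (τ y) = y ∧ ContMDiffAt IN I ∞ τ y := by
  let φ := h.domChart.extend I
  let ψ := h.codChart.extend IN
  let A := h.equiv
  -- In adapted charts the submersion is a linear projection; the section freezes the complementary
  -- coordinate at its value at `x`.
  let k : N → EM := fun y => A.symm (ψ y, (A (φ x)).2)
  have hxφ : x ∈ φ.source := by
    rw [OpenPartialHomeomorph.extend_source]
    exact h.mem_domChart_source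
  have hψx : ψ (pr x) = (A (φ x)).1 := by
    have := h.writtenInCharts (φ.map_source hxφ)
    rw [← show φ.symm (φ x) = x from φ.left_inv hxφ]
    refine this.trans ?_
    rw [show φ.symm (φ x) = x from φ.left_inv hxφ]
    rfl
  have hkx : k (pr x) = φ x := by
    simp only [k, hψx, Prod.mk.eta, A.symm_apply_apply]
  have hksm : ∀ y ∈ h.codChart.source, ContMDiffAt IN 𝓘(ℝ, EM) ∞ k y := by
    intro y hy
    have h1 : ContMDiffAt IN 𝓘(ℝ, EN) ∞ ψ y :=
      h.codChart.contMDiffAt_extend h.codChart_mem_maximalAtlas hy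
    exact A.symm.contDiff.contMDiff.contMDiffAt.comp y (h1.prodMk_space contMDiffAt_const)
  have hφt : IsOpen φ.target := h.domChart.isOpen_extend_target
  have hcod : h.codChart.source ∈ 𝓝 (pr x) :=
    h.codChart.open_source.mem_nhds h.mem_codChart_source
  have hk : ∀ᶠ y in 𝓝 (pr x), k y ∈ φ.target := by
    apply (hksm _ h.mem_codChart_source).continuousAt.eventually
    rw [hkx]
    exact hφt.mem_nhds (φ.map_source hxφ)
  refine ⟨fun y => φ.symm (k y), by simp only [hkx]; exact φ.left_inv hxφ, ?_⟩
  filter_upwards [hk, hcod] with y hy hyc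
  constructor
  · have h1 : φ.symm (k y) ∈ h.domChart.source := by
      have := φ.map_target hy
      rwa [OpenPartialHomeomorph.extend_source] at this
    have h2 := h.writtenInCharts hy
    have h3 : ψ (pr (φ.symm (k y))) = ψ y := h2.trans (by simp [k, A])
    refine ψ.injOn ?_ ?_ h3
    · rw [OpenPartialHomeomorph.extend_source]
      exact h.source_subset_preimage_source h1
    · rwa [OpenPartialHomeomorph.extend_source]
  · have h1 : ContMDiffAt 𝓘(ℝ, EM) I ∞ φ.symm (k y) := by
      have h2 := contMDiffOn_extend_symm h.domChart_mem_maximalAtlas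
      rw [← OpenPartialHomeomorph.extend_target'] at h2
      exact h2.contMDiffAt (hφt.mem_nhds hy)
    exact h1.comp y (hksm y hyc)

theorem Manifold.IsSubmersion.exists_localSection (h : Manifold.IsSubmersion I IN ∞ pr) (x : M) :
    ∃ τ : N → M, τ (pr x) = x ∧
      ∀ᶠ y in 𝓝 (pr x), pr (τ y) = y ∧ ContMDiffAt IN I ∞ τ y := by
  obtain ⟨G, _, _, hG⟩ := h
  exact (hG x).exists_localSection

theorem Manifold.IsSubmersion.contMDiff_of_comp (h : Manifold.IsSubmersion I IN ∞ pr)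
    (hs : Function.Surjective pr) {f : N → ℝ}
    (hf : ContMDiff I 𝓘(ℝ, ℝ) ∞ fun x => f (pr x)) : ContMDiff IN 𝓘(ℝ, ℝ) ∞ f := by
  intro y
  obtain ⟨x, rfl⟩ := hs y
  obtain ⟨τ, -, hτ⟩ := h.exists_localSection x
  have h1 : ContMDiffAt IN 𝓘(ℝ, ℝ) ∞ (fun y => f (pr (τ y))) (pr x) :=
    (hf.contMDiffAt (x := τ (pr x))).comp (pr x) hτ.self_of_nhds.2
  exact h1.congr_of_eventuallyEq (hτ.mono fun y hy => by
    beta_reduce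
    rw [hy.1])

variable {FF : Type*} [NormedAddCommGroup FF] [NormedSpace ℝ FF]
  {F : N → Type*} [TopologicalSpace (TotalSpace FF F)] [∀ y, TopologicalSpace (F y)]
  [FiberBundle FF F]

theorem Manifold.IsSubmersion.contMDiff_section_of_comp (h : Manifold.IsSubmersion I IN ∞ pr)
    (hs : Function.Surjective pr) {σ : ∀ y, F y}
    (hσ : ContMDiff I (IN.prod 𝓘(ℝ, FF)) ∞ fun x => TotalSpace.mk' FF (pr x) (σ (pr x))) :
    ContMDiff IN (IN.prod 𝓘(ℝ, FF)) ∞ fun y => TotalSpace.mk' FF y (σ y) := by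
  intro y
  obtain ⟨x, rfl⟩ := hs y
  obtain ⟨τ, -, hτ⟩ := h.exists_localSection x
  have h1 : ContMDiffAt IN (IN.prod 𝓘(ℝ, FF)) ∞
      (fun y => TotalSpace.mk' FF (pr (τ y)) (σ (pr (τ y)))) (pr x) :=
    (hσ.contMDiffAt (x := τ (pr x))).comp (pr x) hτ.self_of_nhds.2
  exact h1.congr_of_eventuallyEq (hτ.mono fun y hy => by
    beta_reduce
    rw [hy.1])

/-- Smooth functions separate tangent vectors. -/
theorem tangentSpace_eq_zero_of_mfderiv [FiniteDimensional ℝ EN] [IsManifold IN ∞ N] [T2Space N]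
    {y : N} {t : TangentSpace IN y}
    (h : ∀ f : C^∞⟮IN, N; ℝ⟯, mfderiv IN 𝓘(ℝ, ℝ) f y t = 0) : t = 0 := by
  have hs : (chartAt HN y).source ∈ 𝓝 y := chart_source_mem_nhds HN y
  have hinv : (mfderiv IN 𝓘(ℝ, EN) (extChartAt IN y) y).IsInvertible :=
    isInvertible_mfderiv_extChartAt (mem_extChartAt_source y)
  have hφ : ∀ z ∈ (chartAt HN y).source, ContMDiffAt IN 𝓘(ℝ, EN) ∞ (extChartAt IN y) z :=
    fun z hz => contMDiffAt_extChartAt' hz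
  apply hinv.injective
  rw [map_zero]
  change (show EN from mfderiv IN 𝓘(ℝ, EN) (extChartAt IN y) y t) = 0
  rw [← Module.forall_dual_apply_eq_zero_iff ℝ]
  intro l
  -- Linear functionals of the chart, extended to global functions, detect every component of `t`.
  obtain ⟨g, hg⟩ := exists_contMDiffMap_eventuallyEq (I := IN) (x₀ := y)
    (f := fun z => l.toContinuousLinearMap (extChartAt IN y z))
    (Filter.eventually_of_mem hs fun z hz =>
      l.toContinuousLinearMap.contMDiff.contMDiffAt.comp z (hφ z hz))
  have h1 := (l.toContinuousLinearMap.hasMFDerivAt (x := extChartAt IN y y)).comp y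
    ((hφ y (mem_of_mem_nhds hs)).mdifferentiableAt (by simp)).hasMFDerivAt
  have h2 : HasMFDerivAt IN 𝓘(ℝ, ℝ) g y _ := h1.congr_of_eventuallyEq hg
  have h3 := h g
  rw [h2.mfderiv] at h3
  exact h3

end Submersions

/-! ### Existence of the reduced pairing, anchor, bracket and divergence -/

section Reduction

variable {EM : Type*} [NormedAddCommGroup EM] [NormedSpace ℝ EM] [FiniteDimensional ℝ EM]
  {HM : Type*} [TopologicalSpace HM] {I : ModelWithCorners ℝ EM HM} [I.Boundaryless]
  {M : Type*} [TopologicalSpace M] [ChartedSpace HM M] [IsManifold I ∞ M] [T2Space M]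
  {FE : Type*} [NormedAddCommGroup FE] [NormedSpace ℝ FE] [FiniteDimensional ℝ FE]
  {E : M → Type*} [TopologicalSpace (TotalSpace FE E)] [∀ x, TopologicalSpace (E x)]
  [∀ x, AddCommGroup (E x)] [∀ x, Module ℝ (E x)] [FiberBundle FE E] [VectorBundle ℝ FE E]
  [ContMDiffVectorBundle ∞ FE E I]
  {C : CourantAlgebroid I FE E}
  {ES : Type*} [NormedAddCommGroup ES] [NormedSpace ℝ ES] [FiniteDimensional ℝ ES]
  [CompleteSpace ES]
  {HS : Type*} [TopologicalSpace HS] {IS : ModelWithCorners ℝ ES HS} [IS.Boundaryless]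
  {S : Type*} [TopologicalSpace S] [ChartedSpace HS S] [Group S] [LieGroup IS ∞ S]
  [ConnectedSpace S] [MulAction S M] [ContMDiffSMul IS I ∞ S M]
  {K : EquivariantStructure IS S C}
  {EN : Type*} [NormedAddCommGroup EN] [NormedSpace ℝ EN] [FiniteDimensional ℝ EN]
  {HN : Type*} [TopologicalSpace HN] {IN : ModelWithCorners ℝ EN HN} [IN.Boundaryless]
  {N : Type*} [TopologicalSpace N] [ChartedSpace HN N] [IsManifold IN ∞ N] [T2Space N]
  {pr : M → N}
  {FF : Type*} [NormedAddCommGroup FF] [NormedSpace ℝ FF] [FiniteDimensional ℝ FF]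
  {F : N → Type*} [TopologicalSpace (TotalSpace FF F)] [∀ y, TopologicalSpace (F y)]
  [∀ y, AddCommGroup (F y)] [∀ y, Module ℝ (F y)] [FiberBundle FF F] [VectorBundle ℝ FF F]
  [ContMDiffVectorBundle ∞ FF F IN]

/-- A surjective submersion whose fibres are the orbits of `S`. -/
structure IsOrbitMap (I : ModelWithCorners ℝ EM HM) (IN : ModelWithCorners ℝ EN HN) (S : Type*)
    [Group S] [MulAction S M] (pr : M → N) : Prop where
  submersion : Manifold.IsSubmersion I IN ∞ pr
  surjective : Function.Surjective pr
  eq_iff : ∀ x x', pr x = pr x' ↔ ∃ g : S, g • x' = x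

theorem IsOrbitMap.smul_eq (H : IsOrbitMap I IN S pr) (g : S) (x : M) : pr (g • x) = pr x :=
  (H.eq_iff _ _).2 ⟨g, rfl⟩

/-- Smooth functions on the orbit space pull back to smooth functions. -/
noncomputable def IsOrbitMap.pullback (H : IsOrbitMap I IN S pr) (f : C^∞⟮IN, N; ℝ⟯) :
    C^∞⟮I, M; ℝ⟯ := ⟨fun x => f (pr x), f.contMDiff.comp H.submersion.contMDiff⟩

theorem IsOrbitMap.actAt_pullback (H : IsOrbitMap I IN S pr) (f : C^∞⟮IN, N; ℝ⟯) (x : M)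
    (u : E x) : C.actAt (H.pullback f) x u
      = mfderiv IN 𝓘(ℝ, ℝ) f (pr x) (mfderiv I IN pr x (C.anchor x u)) := by
  have h := (f.contMDiff.mdifferentiable (by simp) (pr x)).hasMFDerivAt.comp x
    (H.submersion.contMDiff.mdifferentiable (by simp) x).hasMFDerivAt
  exact congrArg (fun D : EM →L[ℝ] ℝ => D (C.anchor x u)) h.mfderiv

theorem IsOrbitMap.act_χ_pullback (H : IsOrbitMap I IN S pr) (K : EquivariantStructure IS S C)
    (f : C^∞⟮IN, N; ℝ⟯) (s : GroupLieAlgebra IS S) (x : M) :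
    C.act (K.χ s) (H.pullback f) x = 0 := by
  have h := K.integrates_base s (H.pullback f) x
  have h1 : (fun g : S => H.pullback f (g • x)) = fun _ => f (pr x) :=
    funext fun g => congrArg f (H.smul_eq g x)
  have h2 : derivAtOne IS (fun g : S => H.pullback f (g • x)) s
      = -C.act (K.χ s) (H.pullback f) x := h
  rw [h1, derivAtOne_const] at h2
  exact neg_eq_zero.1 h2.symm

/-- Points of one orbit have images that are only propositionally equal, so tangent vectors there
are compared in the total space. -/
theorem tangentBundle_mk_eq {y y' : N} (hy : y = y') {t : TangentSpace IN y}
    {t' : TangentSpace IN y'} (h : ∀ f : C^∞⟮IN, N; ℝ⟯,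
      (show ℝ from mfderiv IN 𝓘(ℝ, ℝ) f y t) = mfderiv IN 𝓘(ℝ, ℝ) f y' t') :
    (⟨y, t⟩ : TangentBundle IN N) = ⟨y', t'⟩ := by
  subst hy
  have : t - t' = 0 := tangentSpace_eq_zero_of_mfderiv (IN := IN) fun f => by
    rw [map_sub]
    exact sub_eq_zero.2 (h f)
  rw [sub_eq_zero.1 this]

namespace EquivariantStructure.QuotientBundleMap

variable (Q : K.QuotientBundleMap IN pr FF F)

theorem q_eq_iff {x : M} {u v : K.sPerp x} : Q.q x u = Q.q x v ↔ (u : E x) - v ∈ K.sE x := by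
  rw [← sub_eq_zero, ← map_sub, Q.eq_zero_iff]
  rfl

theorem exists_lift (x : M) : ∃ l : F (pr x) →ₗ[ℝ] K.sPerp x, ∀ w, Q.q x (l w) = w := by
  obtain ⟨l, hl⟩ := (Q.q x).exists_rightInverse_of_surjective (LinearMap.range_eq_top.2 (Q.surjective x))
  exact ⟨l, fun w => LinearMap.congr_fun hl w⟩

theorem q_pull (g : S) (x : M) (u : K.sPerp (g • x)) :
    (⟨pr x, Q.q x ⟨K.pull g x u, K.pull_mem_sPerp g x u.2⟩⟩ : TotalSpace FF F)
      = ⟨pr (g • x), Q.q (g • x) u⟩ := Q.invariant g x u _ rfl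

theorem pairing_congr_left {x : M} {u u' : K.sPerp x} (h : Q.q x u = Q.q x u') {v : E x}
    (hv : v ∈ K.sPerp x) : C.pairing x u v = C.pairing x u' v := by
  have h1 : C.pairing x ((u : E x) - u') v = 0 := hv _ (Q.q_eq_iff.1 h)
  rw [map_sub, LinearMap.sub_apply, sub_eq_zero] at h1
  exact h1

theorem pairing_congr {x : M} {u u' v v' : K.sPerp x} (hu : Q.q x u = Q.q x u')
    (hv : Q.q x v = Q.q x v') : C.pairing x u v = C.pairing x u' v' := by
  rw [Q.pairing_congr_left hu v.2, C.pairing_symm, Q.pairing_congr_left hv u'.2, C.pairing_symm]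

variable (H : IsOrbitMap I IN S pr)
include H

theorem reduced_pairing (x : M) (u v : K.sPerp x) :
    Q.reduced.pairing (pr x) (Q.q x u) (Q.q x v) = C.pairing x u v := by
  have hex : ∃ B : ∀ y, LinearMap.BilinForm ℝ (F y),
      ∀ x (u v : K.sPerp x), B (pr x) (Q.q x u) (Q.q x v) = C.pairing x u v := by
    -- Over each `y` one point `x₀` and a linear lift define the form. Independence of the point is
    -- invariance of the pairing; independence of the lift holds because `𝔰_E` is orthogonal to
    -- `𝔰_E^⊥`.
    have h : ∀ y, ∃ B : LinearMap.BilinForm ℝ (F y), ∀ x (u v : K.sPerp x) (w w' : F y),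
        (⟨pr x, Q.q x u⟩ : TotalSpace FF F) = ⟨y, w⟩ →
        (⟨pr x, Q.q x v⟩ : TotalSpace FF F) = ⟨y, w'⟩ → B w w' = C.pairing x u v := by
      intro y
      obtain ⟨x₀, rfl⟩ := H.surjective y
      obtain ⟨l, hl⟩ := Q.exists_lift x₀
      refine ⟨(C.pairing x₀).compl₁₂ ((K.sPerp x₀).subtype ∘ₗ l) ((K.sPerp x₀).subtype ∘ₗ l), ?_⟩
      intro x u v w w' hw hw'
      obtain ⟨g, rfl⟩ := (H.eq_iff _ _).1 (congrArg TotalSpace.proj hw)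
      have h1 := TotalSpace.mk_inj.1 ((Q.q_pull g x₀ u).trans hw)
      have h2 := TotalSpace.mk_inj.1 ((Q.q_pull g x₀ v).trans hw')
      rw [← K.pairing_pull]
      exact Q.pairing_congr ((hl w).trans h1.symm) ((hl w').trans h2.symm)
    choose B hB using h
    exact ⟨B, fun x u v => hB _ x u v _ _ rfl rfl⟩
  exact Classical.epsilon_spec hex x u v

theorem reduced_anchor (x : M) (u : K.sPerp x) :
    Q.reduced.anchor (pr x) (Q.q x u) = mfderiv I IN pr x (C.anchor x u) := by
  have hex : ∃ r : ∀ y, F y →ₗ[ℝ] TangentSpace IN y,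
      ∀ x (u : K.sPerp x), r (pr x) (Q.q x u) = mfderiv I IN pr x (C.anchor x u) := by
    have h : ∀ y, ∃ r : F y →ₗ[ℝ] TangentSpace IN y, ∀ x (u : K.sPerp x) (w : F y),
        (⟨pr x, Q.q x u⟩ : TotalSpace FF F) = ⟨y, w⟩ →
        (⟨y, r w⟩ : TangentBundle IN N) = ⟨pr x, mfderiv I IN pr x (C.anchor x u)⟩ := by
      intro y
      obtain ⟨x₀, rfl⟩ := H.surjective y
      obtain ⟨l, hl⟩ := Q.exists_lift x₀
      refine ⟨(show TangentSpace I x₀ →ₗ[ℝ] TangentSpace IN (pr x₀) from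
        (mfderiv I IN pr x₀).toLinearMap) ∘ₗ C.anchor x₀ ∘ₗ (K.sPerp x₀).subtype ∘ₗ l, ?_⟩
      intro x u w hw
      obtain ⟨g, rfl⟩ := (H.eq_iff _ _).1 (congrArg TotalSpace.proj hw)
      have h1 := TotalSpace.mk_inj.1 ((Q.q_pull g x₀ u).trans hw)
      refine tangentBundle_mk_eq (H.smul_eq g x₀).symm fun f => ?_
      -- Tested on functions pulled back from the quotient, which are invariant: the action
      -- preserves their derivatives, and `𝔰_E` kills them.
      have h2 : C.actAt (H.pullback f) x₀ (l w) = C.actAt (H.pullback f) (g • x₀) u := by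
        rw [← K.act_pull (H.act_χ_pullback K f)]
        obtain ⟨s, hs⟩ := Q.q_eq_iff.1 ((hl w).trans h1.symm)
        have h3 : C.actAt (H.pullback f) x₀ (K.χ s x₀) = 0 := H.act_χ_pullback K f s x₀
        rw [hs, map_sub, sub_eq_zero] at h3
        exact h3
      rw [H.actAt_pullback, H.actAt_pullback] at h2
      exact h2
    choose r hr using h
    exact ⟨r, fun x u => TotalSpace.mk_inj.1 (hr _ x u _ rfl)⟩
  exact Classical.epsilon_spec hex x u

variable {Q}

theorem Descends.q_eq {a : Cₛ^∞⟮I; FE, E⟯} {σ : Cₛ^∞⟮IN; FF, F⟯} (h : Q.Descends a σ) (x : M)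
    (hx : a x ∈ K.sPerp x) : Q.q x ⟨a x, hx⟩ = σ (pr x) := (h.2 x).2

omit H in
theorem Descends.mem {a : Cₛ^∞⟮I; FE, E⟯} {σ : Cₛ^∞⟮IN; FF, F⟯} (h : Q.Descends a σ) (x : M) :
    a x ∈ K.sPerp x := (h.2 x).1

omit H in
theorem Descends.sub_mem_sE {a b : Cₛ^∞⟮I; FE, E⟯} {σ : Cₛ^∞⟮IN; FF, F⟯} (h : Q.Descends a σ)
    (h' : Q.Descends b σ) (x : M) : (a - b) x ∈ K.sE x :=
  Q.q_eq_iff.1 ((h.2 x).2.trans (h'.2 x).2.symm)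

omit H in
theorem Descends.congr {a b : Cₛ^∞⟮I; FE, E⟯} {σ : Cₛ^∞⟮IN; FF, F⟯} (h : Q.Descends a σ)
    (hb : K.IsInvariant b) (hab : ∀ x, (b - a) x ∈ K.sE x) : Q.Descends b σ := by
  refine ⟨hb, fun x => ?_⟩
  have hbx : b x ∈ K.sPerp x := by
    have := add_mem (K.sE_le_sPerp x (hab x)) (h.mem x)
    rwa [ContMDiffSection.coe_sub, Pi.sub_apply, sub_add_cancel] at this
  exact ⟨hbx, (Q.q_eq_iff.2 (hab x)).trans (h.2 x).2⟩

omit H in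
theorem Descends.sub {a b : Cₛ^∞⟮I; FE, E⟯} {σ τ : Cₛ^∞⟮IN; FF, F⟯} (h : Q.Descends a σ)
    (h' : Q.Descends b τ) : Q.Descends (a - b) (σ - τ) := by
  refine ⟨h.1.sub h'.1, fun x => ⟨sub_mem (h.mem x) (h'.mem x), ?_⟩⟩
  have := map_sub (Q.q x) ⟨a x, h.mem x⟩ ⟨b x, h'.mem x⟩
  exact this.trans (congrArg₂ _ (h.2 x).2 (h'.2 x).2)

/-- Invariant sections of `𝔰_E^⊥` descend. -/
theorem exists_descends {a : Cₛ^∞⟮I; FE, E⟯} (ha : K.IsInvariant a)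
    (ha' : ∀ x, a x ∈ K.sPerp x) : ∃ σ, Q.Descends a σ := by
  have h : ∀ y, ∃ w : F y, ∀ x, pr x = y →
      (⟨pr x, Q.q x ⟨a x, ha' x⟩⟩ : TotalSpace FF F) = ⟨y, w⟩ := by
    intro y
    obtain ⟨x₀, rfl⟩ := H.surjective y
    refine ⟨Q.q x₀ ⟨a x₀, ha' x₀⟩, fun x hx => ?_⟩
    obtain ⟨g, rfl⟩ := (H.eq_iff _ _).1 hx
    rw [← Q.q_pull]
    congr 2
    exact Subtype.ext (K.pull_eq_of_isInvariant ha g x₀)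
  choose σ hσ using h
  have hσ' : ∀ x, Q.q x ⟨a x, ha' x⟩ = σ (pr x) := fun x => TotalSpace.mk_inj.1 (hσ _ x rfl)
  refine ⟨⟨σ, H.submersion.contMDiff_section_of_comp H.surjective ?_⟩, ha,
    fun x => ⟨ha' x, hσ' x⟩⟩
  exact (Q.smooth a ha').congr fun x => by rw [hσ']

theorem descends_descend {a : Cₛ^∞⟮I; FE, E⟯} (ha : K.IsInvariant a)
    (ha' : ∀ x, a x ∈ K.sPerp x) : Q.Descends a (Q.descend a) :=
  Classical.epsilon_spec (exists_descends (Q := Q) H ha ha')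

/-- Changing either representative by a section of `𝔰_E` changes the bracket by a section of `𝔰_E`.
-/
theorem Descends.bracket {a b : Cₛ^∞⟮I; FE, E⟯} {σ τ : Cₛ^∞⟮IN; FF, F⟯} (ha : Q.Descends a σ)
    (hb : Q.Descends b τ) : Q.Descends (C.bracket a b) (Q.reduced.bracket σ τ) := by
  have hex : ∃ υ, ∀ a b, Q.Descends a σ → Q.Descends b τ → Q.Descends (C.bracket a b) υ := by
    obtain ⟨υ, hυ⟩ := exists_descends (Q := Q) H (ha.1.bracket hb.1)
      (ha.1.bracket_mem_sPerp ha.mem hb.mem)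
    refine ⟨υ, fun a' b' ha' hb' => hυ.congr (ha'.1.bracket hb'.1) fun x => ?_⟩
    have h1 := hb'.1.bracket_mem_sE' hb'.mem (ha'.sub_mem_sE ha) x
    have h2 := ha.1.bracket_mem_sE ha.mem (hb'.sub_mem_sE hb) x
    have h3 : C.bracket a' b' - C.bracket a b
        = C.bracket (a' - a) b' + C.bracket a (b' - b) := by
      rw [C.sub_bracket, C.bracket_sub]
      abel
    rw [h3]
    exact add_mem h1 h2
  exact Classical.epsilon_spec hex a b ha hb

/-- The divergence of an invariant section is constant on orbits, and two representatives differ by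
an invariant section of `𝔰_E`, whose divergence is zero. -/
theorem reducedDiv_apply {div : Divergence C} (hdiv : K.IsEquivariantDiv div)
    {a : Cₛ^∞⟮I; FE, E⟯} {σ : Cₛ^∞⟮IN; FF, F⟯} (ha : Q.Descends a σ) (x : M) :
    Q.reducedDiv div σ (pr x) = div.toLin a x := by
  have hex : ∃ f : C^∞⟮IN, N; ℝ⟯, ∀ a, Q.Descends a σ → ∀ x, f (pr x) = div.toLin a x := by
    have hinv : ∀ (g : S) x, div.toLin a (g • x) = div.toLin a x := K.smul_eq_of_act_eq_zero
      fun s x => by rw [hdiv.equivariant, ha.1 s, map_zero]; rfl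
    have hf : ∀ x, div.toLin a (Function.surjInv H.surjective (pr x)) = div.toLin a x := by
      intro x
      obtain ⟨g, hg⟩ := (H.eq_iff _ _).1 (Function.surjInv_eq H.surjective (pr x))
      rw [← hg, hinv]
    refine ⟨⟨fun y => div.toLin a (Function.surjInv H.surjective y),
      H.submersion.contMDiff_of_comp H.surjective
        ((div.toLin a).contMDiff.congr fun x => hf x)⟩, fun a' ha' x => ?_⟩
    have h0 := IsEquivariantDiv.eq_zero_of_mem_sE hdiv (ha'.1.sub ha.1) (ha'.sub_mem_sE ha) x
    rw [map_sub] at h0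
    exact (hf x).trans (sub_eq_zero.1 h0).symm
  exact Classical.epsilon_spec hex a ha x

end EquivariantStructure.QuotientBundleMap

end Reduction

/-! ### The reduced pseudometric, its projections, and the trace -/

section Reduction

variable {EM : Type*} [NormedAddCommGroup EM] [NormedSpace ℝ EM] [FiniteDimensional ℝ EM]
  {HM : Type*} [TopologicalSpace HM] {I : ModelWithCorners ℝ EM HM} [I.Boundaryless]
  {M : Type*} [TopologicalSpace M] [ChartedSpace HM M] [IsManifold I ∞ M] [T2Space M]
  {FE : Type*} [NormedAddCommGroup FE] [NormedSpace ℝ FE] [FiniteDimensional ℝ FE]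
  {E : M → Type*} [TopologicalSpace (TotalSpace FE E)] [∀ x, TopologicalSpace (E x)]
  [∀ x, AddCommGroup (E x)] [∀ x, Module ℝ (E x)] [FiberBundle FE E] [VectorBundle ℝ FE E]
  [ContMDiffVectorBundle ∞ FE E I]
  {C : CourantAlgebroid I FE E}
  {ES : Type*} [NormedAddCommGroup ES] [NormedSpace ℝ ES] [FiniteDimensional ℝ ES]
  [CompleteSpace ES]
  {HS : Type*} [TopologicalSpace HS] {IS : ModelWithCorners ℝ ES HS} [IS.Boundaryless]
  {S : Type*} [TopologicalSpace S] [ChartedSpace HS S] [Group S] [LieGroup IS ∞ S]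
  [ConnectedSpace S] [MulAction S M] [ContMDiffSMul IS I ∞ S M]
  {K : EquivariantStructure IS S C}
  {EN : Type*} [NormedAddCommGroup EN] [NormedSpace ℝ EN] [FiniteDimensional ℝ EN]
  {HN : Type*} [TopologicalSpace HN] {IN : ModelWithCorners ℝ EN HN} [IN.Boundaryless]
  {N : Type*} [TopologicalSpace N] [ChartedSpace HN N] [IsManifold IN ∞ N] [T2Space N]
  {pr : M → N}
  {FF : Type*} [NormedAddCommGroup FF] [NormedSpace ℝ FF] [FiniteDimensional ℝ FF]
  {F : N → Type*} [TopologicalSpace (TotalSpace FF F)] [∀ y, TopologicalSpace (F y)]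
  [∀ y, AddCommGroup (F y)] [∀ y, Module ℝ (F y)] [FiberBundle FF F] [VectorBundle ℝ FF F]
  [ContMDiffVectorBundle ∞ FF F IN]

namespace EquivariantStructure.QuotientBundleMap

variable {Q : K.QuotientBundleMap IN pr FF F} (H : IsOrbitMap I IN S pr)
  {V : ∀ x, Submodule ℝ (E x)} (hV : K.IsAdmissible V)

theorem mem_reducedSubbundle_of_mem {x : M} {u : K.sPerp x} (hu : (u : E x) ∈ V x) :
    Q.q x u ∈ Q.reducedSubbundle V (pr x) :=
  Submodule.subset_span ⟨x, u, hu, rfl⟩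

include hV in
-- The difference lies in `V` and in `𝔰_E`, hence is orthogonal to `V`, and the pairing is
-- nondegenerate on `V`.
theorem eq_of_q_eq {x : M} {u v : K.sPerp x} (hu : (u : E x) ∈ V x) (hv : (v : E x) ∈ V x)
    (h : Q.q x u = Q.q x v) : u = v := by
  rw [Q.q_eq_iff] at h
  refine Subtype.ext (sub_eq_zero.1 (hV.pseudometric.nondegenerate x _ (sub_mem hu hv) ?_))
  exact fun w hw => hV.le_sPerp x hw _ h

include H hV

theorem mem_reducedSubbundle {x : M} {w : F (pr x)} (hw : w ∈ Q.reducedSubbundle V (pr x)) :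
    ∃ u : K.sPerp x, (u : E x) ∈ V x ∧ Q.q x u = w := by
  induction hw using Submodule.span_induction with
  | mem w h =>
    obtain ⟨x', u, hu, h⟩ := h
    obtain ⟨g, rfl⟩ := (H.eq_iff _ _).1 (congrArg TotalSpace.proj h)
    exact ⟨_, hV.pull_mem g x hu, TotalSpace.mk_inj.1 ((Q.q_pull g x u).trans h)⟩
  | zero => exact ⟨0, zero_mem _, map_zero _⟩
  | add w w' _ _ h h' =>
    obtain ⟨u, hu, rfl⟩ := h
    obtain ⟨u', hu', rfl⟩ := h'
    exact ⟨u + u', add_mem hu hu', map_add _ _ _⟩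
  | smul c w _ h =>
    obtain ⟨u, hu, rfl⟩ := h
    exact ⟨c • u, Submodule.smul_mem _ c hu, map_smul _ _ _⟩

theorem exists_reducedEquiv (x : M) : ∃ e : V x ≃ₗ[ℝ] Q.reducedSubbundle V (pr x),
    ∀ u, (e u : F (pr x)) = Q.q x ⟨u, hV.le_sPerp x u.2⟩ := by
  let f : V x →ₗ[ℝ] Q.reducedSubbundle V (pr x) :=
    (Q.q x ∘ₗ Submodule.inclusion (hV.le_sPerp x)).codRestrict _
      fun u => mem_reducedSubbundle_of_mem (u := Submodule.inclusion (hV.le_sPerp x) u) u.2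
  have hf : ∀ u, (f u : F (pr x)) = Q.q x ⟨u, hV.le_sPerp x u.2⟩ := fun u => rfl
  refine ⟨LinearEquiv.ofBijective f ⟨fun u v h => ?_, fun w => ?_⟩, hf⟩
  · have := eq_of_q_eq (Q := Q) hV u.2 v.2 (congrArg Subtype.val h)
    exact Subtype.ext (Subtype.ext_iff.1 this :)
  · obtain ⟨u, hu, h⟩ := mem_reducedSubbundle H hV w.2
    exact ⟨⟨u, hu⟩, Subtype.ext h⟩

theorem q_mem_minus_iff {x : M} (u : K.sPerp x) :
    Q.q x u ∈ Q.reduced.minus (Q.reducedSubbundle V) (pr x) ↔ (u : E x) ∈ C.minus V x := by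
  constructor
  · intro h v hv
    have := h (Q.q x ⟨v, hV.le_sPerp x hv⟩) (mem_reducedSubbundle_of_mem hv)
    exact (Q.reduced_pairing H x _ _).symm.trans this
  · intro h w hw
    obtain ⟨v, hv, rfl⟩ := mem_reducedSubbundle H hV hw
    exact (Q.reduced_pairing H x _ _).trans (h v hv)

theorem eq_zero_of_mem_reducedSubbundle {y : N} {w : F y} (hw : w ∈ Q.reducedSubbundle V y)
    (hw' : w ∈ Q.reduced.minus (Q.reducedSubbundle V) y) : w = 0 := by
  obtain ⟨x, rfl⟩ := H.surjective y
  obtain ⟨u, hu, rfl⟩ := mem_reducedSubbundle H hV hw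
  rw [q_mem_minus_iff H hV] at hw'
  have := CourantAlgebroid.eq_zero_of_mem_of_mem_minus hV.pseudometric hu hw'
  rw [Subtype.ext (a2 := (0 : K.sPerp x)) this, map_zero]

/-- The section induced by `a₊` has the property defining the projection of `σ`, and the reduced
subbundle meets its orthogonal only in zero, so that property has a unique solution. -/
theorem Descends.plusPart {a : Cₛ^∞⟮I; FE, E⟯} {σ : Cₛ^∞⟮IN; FF, F⟯} (h : Q.Descends a σ) :
    Q.Descends (C.plusPart V a) (Q.reduced.plusPart (Q.reducedSubbundle V) σ) := by
  have hp := CourantAlgebroid.plusPart_spec hV.pseudometric a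
  obtain ⟨s, hs⟩ := exists_descends (Q := Q) H (hV.isInvariant_plusPart h.1)
    fun x => hV.le_sPerp x (hp x).1
  have hspec : ∀ y, s y ∈ Q.reducedSubbundle V y
      ∧ σ y - s y ∈ Q.reduced.minus (Q.reducedSubbundle V) y := by
    intro y
    obtain ⟨x, rfl⟩ := H.surjective y
    rw [← hs.q_eq H x (hs.mem x)]
    refine ⟨mem_reducedSubbundle_of_mem (hp x).1, ?_⟩
    rw [← h.q_eq H x (h.mem x), ← map_sub, q_mem_minus_iff H hV]
    exact (hp x).2
  have heps := Classical.epsilon_spec (⟨s, hspec⟩ : ∃ s : Cₛ^∞⟮IN; FF, F⟯,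
    ∀ y, s y ∈ Q.reducedSubbundle V y
      ∧ σ y - s y ∈ Q.reduced.minus (Q.reducedSubbundle V) y)
  have : s = Q.reduced.plusPart (Q.reducedSubbundle V) σ := by
    ext y
    refine sub_eq_zero.1 (eq_zero_of_mem_reducedSubbundle H hV
      (sub_mem (hspec y).1 (heps y).1) ?_)
    have := sub_mem (heps y).2 (hspec y).2
    rwa [sub_sub_sub_cancel_left] at this
  exact this ▸ hs

theorem Descends.minusPart {a : Cₛ^∞⟮I; FE, E⟯} {σ : Cₛ^∞⟮IN; FF, F⟯} (h : Q.Descends a σ) :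
    Q.Descends (C.minusPart V a) (Q.reduced.minusPart (Q.reducedSubbundle V) σ) :=
  h.sub (h.plusPart H hV)

/-- A section of the reduced subbundle through a given vector. -/
theorem exists_section_reducedSubbundle {x : M} {w : F (pr x)}
    (hw : w ∈ Q.reducedSubbundle V (pr x)) : ∃ σ : Cₛ^∞⟮IN; FF, F⟯,
      (∀ y, σ y ∈ Q.reducedSubbundle V y) ∧ σ (pr x) = w := by
  obtain ⟨u, hu, rfl⟩ := mem_reducedSubbundle H hV hw
  obtain ⟨a, ha, hau⟩ := hV.pseudometric.subbundle.exists_section hu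
  have ha' := fun x => hV.le_sPerp x (ha x)
  -- The lift `a` need not be invariant: its class is transported to the base along the local
  -- section `τ` and then cut off.
  obtain ⟨τ, hτx, hτ⟩ := H.submersion.exists_localSection x
  have hex : ∀ y, ∃ w : F y, w ∈ Q.reducedSubbundle V y ∧ (pr (τ y) = y →
      (⟨y, w⟩ : TotalSpace FF F) = ⟨pr (τ y), Q.q (τ y) ⟨a (τ y), ha' _⟩⟩) := by
    intro y
    by_cases hy : pr (τ y) = y
    · have : ∀ z, pr (τ y) = z → ∃ w : F z, w ∈ Q.reducedSubbundle V z ∧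
          (⟨z, w⟩ : TotalSpace FF F) = ⟨pr (τ y), Q.q (τ y) ⟨a (τ y), ha' _⟩⟩ := by
        rintro _ rfl
        exact ⟨_, mem_reducedSubbundle_of_mem (ha _), rfl⟩
      obtain ⟨w, hw, h⟩ := this y hy
      exact ⟨w, hw, fun _ => h⟩
    · exact ⟨0, zero_mem _, fun h => absurd h hy⟩
  choose σ hσ hσ' using hex
  have hτσ : ∀ᶠ y in 𝓝 (pr x), ContMDiffAt IN (IN.prod 𝓘(ℝ, FF)) ∞
      (fun y => TotalSpace.mk' FF y (σ y)) y := by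
    filter_upwards [hτ.eventually_nhds] with y hy
    have h1 : ContMDiffAt IN (IN.prod 𝓘(ℝ, FF)) ∞ (fun y =>
        (⟨pr (τ y), Q.q (τ y) ⟨a (τ y), ha' _⟩⟩ : TotalSpace FF F)) y :=
      ((Q.smooth a ha').contMDiffAt (x := τ y)).comp y hy.self_of_nhds.2
    exact h1.congr_of_eventuallyEq (hy.mono fun z hz => hσ' z hz.1)
  obtain ⟨ψ, hψ, hψ'⟩ := exists_cutoff (I := IN) hτσ
  refine ⟨⟨fun y => ψ y • σ y, contMDiff_cutoff_section hψ' fun y hy => hy⟩,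
    fun y => Submodule.smul_mem _ _ (hσ y), ?_⟩
  change ψ (pr x) • σ (pr x) = _
  rw [hψ.self_of_nhds, one_smul]
  refine TotalSpace.mk_inj.1 ((hσ' (pr x) (congrArg pr hτx)).trans ?_)
  have hcongr : ∀ x', x' = x → (⟨pr x', Q.q x' ⟨a x', ha' x'⟩⟩ : TotalSpace FF F)
      = ⟨pr x, Q.q x ⟨a x, ha' x⟩⟩ := by
    rintro _ rfl
    rfl
  rw [hcongr _ hτx]
  exact congrArg (fun v => (⟨pr x, Q.q x v⟩ : TotalSpace FF F)) (Subtype.ext hau)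

/-- Sections of the reduced subbundle lift to invariant sections of `V`. -/
theorem exists_descends_of_mem {σ : Cₛ^∞⟮IN; FF, F⟯} (hσ : ∀ y, σ y ∈ Q.reducedSubbundle V y) :
    ∃ a : Cₛ^∞⟮I; FE, E⟯, (∀ x, a x ∈ V x) ∧ Q.Descends a σ := by
  choose u hu hq using fun x => mem_reducedSubbundle H hV (hσ (pr x))
  have hsmooth : ContMDiff I (I.prod 𝓘(ℝ, FE)) ∞ fun x => TotalSpace.mk' FE x (u x : E x) := by
    intro x₀
    obtain ⟨r, e, he⟩ := hV.pseudometric.subbundle.exists_frame x₀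
    have he' := fun i x => hV.le_sPerp x (he.mem i x)
    have hex : ∀ x, ∃ c : Fin r → ℝ, IsFrameAt V e x → (u x : E x) = ∑ i, c i • e i x := by
      intro x
      by_cases hx : IsFrameAt V e x
      · obtain ⟨c, hc⟩ := hx.exists_coeff (hu x)
        exact ⟨c, fun _ => hc⟩
      · exact ⟨0, fun h => absurd h hx⟩
    choose c hc using hex
    have hc' : ∀ᶠ x in 𝓝 x₀, (u x : E x) = ∑ i, c x i • e i x := he.nearby.mono hc
    have hpr : ∀ᶠ x in 𝓝 x₀, pr x ∈ (trivializationAt FF F (pr x₀)).baseSet :=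
      H.submersion.contMDiff.continuous.continuousAt.eventually
        ((trivializationAt FF F (pr x₀)).open_baseSet.mem_nhds
          (mem_baseSet_trivializationAt FF F (pr x₀)))
    -- The quotient map is injective on `V`, so these are also the coefficients of `σ` along `pr` in
    -- the images of the frame, where smoothness is known.
    have hcs : ∀ i, ContMDiffAt I 𝓘(ℝ, ℝ) ∞ (fun x => c x i) x₀ := by
      refine fun i => contMDiffAt_coeff (G := FF) (c := fun i x => c x i)
        (w := fun i x => (trivializationAt FF F (pr x₀) ⟨pr x, Q.q x ⟨e i x, he' i x⟩⟩).2)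
        (t := fun x => (trivializationAt FF F (pr x₀) ⟨pr x, σ (pr x)⟩).2) ?_ ?_ ?_ ?_ i
      · exact fun i => (contMDiffAt_totalSpace.1 (Q.smooth (e i) (he' i)).contMDiffAt).2
      · exact (contMDiffAt_totalSpace.1
          (σ.contMDiff.comp H.submersion.contMDiff).contMDiffAt).2
      · refine IsFrameAt.linearIndependent_coord (mem_baseSet_trivializationAt FF F (pr x₀)) ?_
        obtain ⟨l, hl⟩ := exists_reducedEquiv (Q := Q) H hV x₀
        have h1 : LinearIndependent ℝ fun i => (⟨e i x₀, he.mem i x₀⟩ : V x₀) :=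
          LinearIndependent.of_comp (V x₀).subtype he.frame.self_of_nhds.1
        have h2 := h1.map' ((Submodule.subtype _) ∘ₗ l.toLinearMap)
          (LinearMap.ker_eq_bot.2 (Subtype.val_injective.comp l.injective))
        rwa [show _ = _ from funext fun i => (hl ⟨e i x₀, he.mem i x₀⟩).symm]
      · filter_upwards [hc', hpr] with x hx hb
        rw [← IsFrameAt.coord_sum hb, ← hq x]
        simp only [← map_smul, ← map_sum]
        congr 4
        refine Subtype.ext ?_
        rw [hx]
        simp
    have hsum : ContMDiffAt I (I.prod 𝓘(ℝ, FE)) ∞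
        (fun x => TotalSpace.mk' FE x (∑ i, c x i • e i x)) x₀ := by
      refine ContMDiffAt.sum_section fun i _ => ?_
      exact (hcs i).smul_section (e i).contMDiff.contMDiffAt
    exact hsum.congr_of_eventuallyEq (hc'.mono fun x hx => by beta_reduce; rw [hx])
  refine ⟨⟨_, hsmooth⟩, hu, K.isInvariant_of_pull_eq fun g x => ?_, fun x => ⟨(u x).2, hq x⟩⟩
  -- Invariance follows from uniqueness of the lift in `V x`.
  have h1 := (Q.q_pull g x (u (g • x)))
  have h2 : (⟨pr (g • x), Q.q (g • x) (u (g • x))⟩ : TotalSpace FF F) = ⟨pr x, Q.q x (u x)⟩ := by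
    rw [hq, hq, H.smul_eq]
  exact congrArg Subtype.val
    (eq_of_q_eq hV (hV.pull_mem g x (hu _)) (hu x) (TotalSpace.mk_inj.1 (h1.trans h2)))

theorem trace_ricciEnd {a b : Cₛ^∞⟮I; FE, E⟯} {σ τ : Cₛ^∞⟮IN; FF, F⟯} (ha : ∀ x, a x ∈ V x)
    (hb : ∀ x, b x ∈ C.minus V x) (hσ : Q.Descends a σ) (hτ : Q.Descends b τ) (x : M) :
    LinearMap.trace ℝ _ (Q.reduced.ricciEnd (Q.reducedSubbundle V) σ τ (pr x))
      = LinearMap.trace ℝ _ (C.ricciEnd V a b x) := by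
  obtain ⟨e, he⟩ := exists_reducedEquiv (Q := Q) H hV x
  have hspec : ∀ (v : Cₛ^∞⟮IN; FF, F⟯) (hv : ∀ y, v y ∈ Q.reducedSubbundle V y),
      (e.conj (C.ricciEnd V a b x) ⟨v (pr x), hv (pr x)⟩ : F (pr x))
        = Q.reduced.plusPart (Q.reducedSubbundle V) (Q.reduced.bracket
            (Q.reduced.minusPart (Q.reducedSubbundle V) (Q.reduced.bracket v τ)) σ) (pr x) := by
    intro v hv
    -- Evaluating on an invariant lift keeps all the iterated brackets and projections among
    -- sections that descend.
    obtain ⟨u, hu, hd⟩ := exists_descends_of_mem H hV hv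
    have h1 : e ⟨u x, hu x⟩ = ⟨v (pr x), hv (pr x)⟩ :=
      Subtype.ext ((he _).trans (hd.q_eq H x _))
    rw [← h1, LinearEquiv.conj_apply_apply, LinearEquiv.symm_apply_apply, he,
      ← ((((hd.bracket H hτ).minusPart H hV).bracket H hσ).plusPart H hV).q_eq H x
        (hV.le_sPerp x (CourantAlgebroid.plusPart_spec hV.pseudometric _ x).1)]
    congr 2
    exact CourantAlgebroid.ricciEnd_spec hV.pseudometric ha hb x u hu
  have heps := Classical.epsilon_spec (⟨_, hspec⟩ :
    ∃ T : Module.End ℝ (Q.reducedSubbundle V (pr x)),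
      ∀ (v : Cₛ^∞⟮IN; FF, F⟯) (hv : ∀ y, v y ∈ Q.reducedSubbundle V y),
      (T ⟨v (pr x), hv (pr x)⟩ : F (pr x))
        = Q.reduced.plusPart (Q.reducedSubbundle V) (Q.reduced.bracket
            (Q.reduced.minusPart (Q.reducedSubbundle V) (Q.reduced.bracket v τ)) σ) (pr x))
  have : Q.reduced.ricciEnd (Q.reducedSubbundle V) σ τ (pr x) = e.conj (C.ricciEnd V a b x) := by
    refine LinearMap.ext fun w => Subtype.ext ?_
    obtain ⟨w, hw⟩ := w
    obtain ⟨v, hv, rfl⟩ := exists_section_reducedSubbundle H hV hw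
    exact (heps v hv).trans (hspec v hv).symm
  rw [this, LinearMap.trace_conj']

/-- The generalized Ricci tensor is compatible with reduction. -/
theorem GRic_eq_reduced {div : Divergence C} (hdiv : K.IsEquivariantDiv div)
    {a b : Cₛ^∞⟮I; FE, E⟯} {σ τ : Cₛ^∞⟮IN; FF, F⟯} (ha : ∀ x, a x ∈ V x)
    (hb : ∀ x, b x ∈ C.minus V x) (hσ : Q.Descends a σ) (hτ : Q.Descends b τ) (x : M) :
    C.GRic V div.toLin a b x
      = Q.reduced.GRic (Q.reducedSubbundle V) (Q.reducedDiv div) σ τ (pr x) := by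
  have h1 := reducedDiv_apply H hdiv ((hτ.bracket H hσ).plusPart H hV) x
  have h2 : Q.reduced.act τ (Q.reducedDiv div σ) (pr x) = C.act b (div.toLin a) x := by
    have h3 : div.toLin a = H.pullback (Q.reducedDiv div σ) := by
      ext x
      exact (reducedDiv_apply H hdiv hσ x).symm
    rw [h3, C.act_eq_actAt, H.actAt_pullback]
    have h4 := Q.reduced_anchor H x ⟨b x, hτ.mem x⟩
    rw [hτ.q_eq H] at h4
    exact congrArg (mfderiv IN 𝓘(ℝ, ℝ) (Q.reducedDiv div σ) (pr x)) h4
  unfold CourantData.GRic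
  rw [h1, h2, trace_ricciEnd H hV ha hb hσ hτ]

end EquivariantStructure.QuotientBundleMap

end Reduction

theorem mainTheorem4
    {EM : Type*} [NormedAddCommGroup EM] [NormedSpace ℝ EM] [FiniteDimensional ℝ EM]
    {HM : Type*} [TopologicalSpace HM] (I : ModelWithCorners ℝ EM HM) [I.Boundaryless]
    {M : Type*} [TopologicalSpace M] [ChartedSpace HM M] [IsManifold I ∞ M]
    [T2Space M] [SecondCountableTopology M]
    {FE : Type*} [NormedAddCommGroup FE] [NormedSpace ℝ FE] [FiniteDimensional ℝ FE]
    {E : M → Type*} [TopologicalSpace (TotalSpace FE E)] [∀ x, TopologicalSpace (E x)]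
    [∀ x, AddCommGroup (E x)] [∀ x, Module ℝ (E x)] [FiberBundle FE E] [VectorBundle ℝ FE E]
    [ContMDiffVectorBundle ∞ FE E I]
    (C : CourantAlgebroid I FE E)
    -- a connected Lie group acting smoothly, freely and properly on `M`
    {ES : Type*} [NormedAddCommGroup ES] [NormedSpace ℝ ES] [FiniteDimensional ℝ ES]
    [CompleteSpace ES]
    {HS : Type*} [TopologicalSpace HS] (IS : ModelWithCorners ℝ ES HS) [IS.Boundaryless]
    {S : Type*} [TopologicalSpace S] [ChartedSpace HS S] [Group S] [LieGroup IS ∞ S]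
    [ConnectedSpace S] [MulAction S M] [ContMDiffSMul IS I ∞ S M] [ProperSMul S M]
    (hfree : ∀ (g : S) (x : M), g • x = x → g = 1)
    (K : EquivariantStructure IS S C)
    -- the quotient manifold `M/S`
    {EN : Type*} [NormedAddCommGroup EN] [NormedSpace ℝ EN] [FiniteDimensional ℝ EN]
    {HN : Type*} [TopologicalSpace HN] (IN : ModelWithCorners ℝ EN HN) [IN.Boundaryless]
    [ChartedSpace HN (MulAction.orbitRel.Quotient S M)]
    [IsManifold IN ∞ (MulAction.orbitRel.Quotient S M)]
    (hπ : Manifold.IsSubmersion I IN ∞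
      (Quotient.mk _ : M → MulAction.orbitRel.Quotient S M))
    -- the quotient vector bundle `(𝔰_E^⊥ / 𝔰_E) / S`
    {FF : Type*} [NormedAddCommGroup FF] [NormedSpace ℝ FF] [FiniteDimensional ℝ FF]
    {F : MulAction.orbitRel.Quotient S M → Type*} [TopologicalSpace (TotalSpace FF F)]
    [∀ y, TopologicalSpace (F y)] [∀ y, AddCommGroup (F y)] [∀ y, Module ℝ (F y)]
    [FiberBundle FF F] [VectorBundle ℝ FF F] [ContMDiffVectorBundle ∞ FF F IN]
    (Q : K.QuotientBundleMap IN (Quotient.mk _ : M → MulAction.orbitRel.Quotient S M) FF F)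
    (V : ∀ x, Submodule ℝ (E x)) (hV : K.IsAdmissible V)
    (div : Divergence C) (hdiv : K.IsEquivariantDiv div)
    (a b : Cₛ^∞⟮I; FE, E⟯)
    (ha : ∀ x, a x ∈ V x) (ha_inv : K.IsInvariant a)
    (hb : ∀ x, b x ∈ C.minus V x ∧ b x ∈ K.sPerp x) (hb_inv : K.IsInvariant b) :
    ∀ x, C.GRic V div.toLin a b x
      = Q.reduced.GRic (Q.reducedSubbundle V) (Q.reducedDiv div) (Q.descend a) (Q.descend b)
          (Quotient.mk _ x) := by
  have H : IsOrbitMap I IN S (Quotient.mk _ : M → MulAction.orbitRel.Quotient S M) :=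
    ⟨hπ, Quotient.mk_surjective, fun x x' => by
      rw [Quotient.eq, MulAction.orbitRel_apply]
      rfl⟩
  have ha' := fun x => hV.le_sPerp x (ha x)
  have hb' := fun x => (hb x).2
  -- Properness of the action makes the orbit space Hausdorff, as the cutoff functions on it
  -- require.
  exact EquivariantStructure.QuotientBundleMap.GRic_eq_reduced H hV hdiv ha (fun x => (hb x).1)
    (EquivariantStructure.QuotientBundleMap.descends_descend H ha_inv ha')
    (EquivariantStructure.QuotientBundleMap.descends_descend H hb_inv hb')
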